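/- **Theorem 1.1 (Lower bound).** Let $N\ge 2$, let $\Omega\subset\mathbb R^N$ be a bounded domain, and let $0<t^*<\infty$. Let $\delta_i,h_i,k_i$ ($i=1,2$) be positive functions on $(0,t^*)$ and let $f_1,f_2$ be functions with $$0\le f_1(s)\le s^p,\qquad 0\le f_2(s)\le s^q\qquad (s\ge 0),\qquad p\ge q>1,$$ where $2p<\frac{2N}{N-4}$ if $N>4$ (no further restriction if $N\le 4$). Let $(u,v)$ be a nonnegative solution on $[0,t^*)$ of $$u_t+\delta_1(t)\Delta^2u-h_1(t)\Delta u=k_1(t)f_1(v),\qquad v_t+\delta_2(t)\Delta^2v-h_2(t)\Delta v=k_2(t)f_2(u)\qquad\text{in }\Omega\times(0,t^*),$$ with $u=v=0$, $\partial u/\partial n=\partial v/\partial n=0$ on $\partial\Omega$ and initial values $u_0,v_0\in W^{2,2}_0(\Omega)$; that is, for every $0<T'<t^*$, both $u$ and $v$ lie in $C([0,T'];W^{2,2}_0(\Omega))\cap L^2(0,T';W^{4,2}(\Omega))\cap W^{1,2}(0,T';L^2(\Omega))$, $f_1(v),f_2(u)\in L^2(0,T';L^2(\Omega))$, the equations hold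 almost everywhere, and $u(0)=u_0$, $v(0)=v_0$. Put $$\Phi(t)=\|\Delta u(t)\|_2^2+\|\Delta v(t)\|_2^2,\qquad \Phi_0=\|\Delta u_0\|_2^2+\|\Delta v_0\|_2^2,$$ and assume $\Phi_0>0$. For $r\in\{2p,2q\}$ let $S_r$ be the best constant in $\|w\|_r\le S_r\|\Delta w\|_2$, $w\in W_0^{2,2}(\Omega)$ (it is finite). Let $\varepsilon_1,\dots,\varepsilon_4$ be any positive functions on $(0,t^*)$ with $$\frac{h_1}{\varepsilon_2}+\frac{k_1}{\varepsilon_1}=2\delta_1,\qquad \frac{h_2}{\varepsilon_4}+\frac{k_2}{\varepsilon_3}=2\delta_2,$$ such that the following suprema over $t\in(0,t^*)$ are finite: $$B=\max\Big\{\sup_t h_1\varepsilon_2,\ \sup_t h_2\varepsilon_4\Big\},\quad A=\max\Big\{\sup_t k_2\varepsilon_3\,S_{2q}^{2q}\,\Phi_0^{q-p},\ \sup_t k_1\varepsilon_1\,S_{2p}^{2p}\Big\},\quad \widetilde A=S_{2p}^{2p}\max\Big\{\sup_t k_2\varepsilon_3,\ \sup_t k_1\varepsilon_1\Big\}.$$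 Define $$T=\frac1{B(p-1)}\ln\Big[1+\frac{B}{2A}\Phi_0^{1-p}\Big]\ \text{ if } p>q,\qquad T=\frac1{B(p-1)}\ln\Big[1+\frac{B}{\widetilde A}\Phi_0^{1-p}\Big]\ \text{ if } p=q.$$ Then $\Phi$ is bounded on $[0,T]\cap[0,t^*)$. If moreover $t^*$ is the blow-up time, in the sense that $\lim_{t\to t^*}\Phi(t)=\infty$, then $T<t^*$, and $\Phi$ is bounded on $[0,T]$. -/

import Mathlib

open MeasureTheory Set Filter Topology
open scoped ENNReal ContDiff

namespace FourthOrder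

variable {N : ℕ}

/-- The real Hilbert space `L²(Ω)`, for the Lebesgue measure on `Ω ⊆ ℝᴺ`. -/
abbrev L2 (Ω : Set (EuclideanSpace ℝ (Fin N))) : Type :=
  Lp ℝ 2 (volume.restrict Ω)

/-- Test functions, the elements of `C_c^∞(Ω)`. -/
structure IsTest (Ω : Set (EuclideanSpace ℝ (Fin N)))
    (φ : EuclideanSpace ℝ (Fin N) → ℝ) : Prop where
  smooth : ContDiff ℝ ∞ φ
  compact : HasCompactSupport φ
  supp : tsupport φ ⊆ Ω

/-- The classical partial derivative `∂_{α 0} ⋯ ∂_{α (k-1)} φ` of order `k` at `x`. -/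
noncomputable def partialDeriv {k : ℕ} (α : Fin k → Fin N)
    (φ : EuclideanSpace ℝ (Fin N) → ℝ) (x : EuclideanSpace ℝ (Fin N)) : ℝ :=
  iteratedFDeriv ℝ k φ x (fun j => EuclideanSpace.single (α j) (1 : ℝ))

/-- `g ∈ L²(Ω)` is the weak partial derivative of `w ∈ L²(Ω)` in the directions `α`. -/
def IsWeakDeriv (Ω : Set (EuclideanSpace ℝ (Fin N))) {k : ℕ} (α : Fin k → Fin N)
    (w g : L2 Ω) : Prop :=
  ∀ φ : EuclideanSpace ℝ (Fin N) → ℝ, IsTest Ω φ →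
    ∫ x in Ω, w x * partialDeriv α φ x = (-1) ^ k * ∫ x in Ω, g x * φ x

/-- `w ∈ W₀^{m,2}(Ω)`: `w` has weak derivatives in `L²(Ω)` up to order `m`, and it is a limit of
test functions in the norm of `W^{m,2}(Ω)`. -/
def MemW0 (Ω : Set (EuclideanSpace ℝ (Fin N))) (m : ℕ) (w : L2 Ω) : Prop :=
  ∃ G : (k : ℕ) → (Fin k → Fin N) → L2 Ω,
    (∀ k ≤ m, ∀ α : Fin k → Fin N, IsWeakDeriv Ω α w (G k α)) ∧
    ∀ ε : ℝ, 0 < ε → ∃ φ : EuclideanSpace ℝ (Fin N) → ℝ, IsTest Ω φ ∧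
      ∀ k ≤ m, ∀ α : Fin k → Fin N,
        eLpNorm (fun x => partialDeriv α φ x - G k α x) 2 (volume.restrict Ω) ≤ ENNReal.ofReal ε

/-- `g ∈ L²(Ω)` is the weak (distributional) Laplacian of `w ∈ L²(Ω)`. -/
def IsWeakLaplacian (Ω : Set (EuclideanSpace ℝ (Fin N))) (w g : L2 Ω) : Prop :=
  ∀ φ : EuclideanSpace ℝ (Fin N) → ℝ, IsTest Ω φ →
    ∫ x in Ω, w x * Laplacian.laplacian φ x = ∫ x in Ω, g x * φ x

open Classical in
/-- The weak Laplacian `Δw` of `w ∈ L²(Ω)`; it is `0` if `w` has no weak Laplacian in `L²(Ω)`. -/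
noncomputable def weakLaplacian (Ω : Set (EuclideanSpace ℝ (Fin N))) (w : L2 Ω) : L2 Ω :=
  if h : ∃ g : L2 Ω, IsWeakLaplacian Ω w g then h.choose else 0

/-- The weak Laplacian is unique, so that `weakLaplacian` does not depend on a choice. -/
theorem IsWeakLaplacian.eq_weakLaplacian {Ω : Set (EuclideanSpace ℝ (Fin N))} (hΩ : IsOpen Ω)
    {w g : L2 Ω} (hg : IsWeakLaplacian Ω w g) : weakLaplacian Ω w = g := by
  have hex : ∃ g : L2 Ω, IsWeakLaplacian Ω w g := ⟨g, hg⟩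
  have hspec : IsWeakLaplacian Ω w (weakLaplacian Ω w) := by
    unfold weakLaplacian
    rw [dif_pos hex]
    exact hex.choose_spec
  set g' := weakLaplacian Ω w
  have hloc : LocallyIntegrableOn (fun x => g' x - g x) Ω := by
    have h2 : MemLp (fun x => g' x - g x) 2 (volume.restrict Ω) := (Lp.memLp g').sub (Lp.memLp g)
    exact locallyIntegrableOn_of_locallyIntegrable_restrict (h2.locallyIntegrable (by norm_num))
  have key := hΩ.ae_eq_zero_of_integral_contDiff_smul_eq_zero hloc (by
    intro φ hφ hc hs
    have hφL : MemLp φ 2 (volume.restrict Ω) :=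
      (hφ.continuous.memLp_of_hasCompactSupport hc)
    have e1 := hspec φ ⟨hφ, hc, hs⟩
    have e2 := hg φ ⟨hφ, hc, hs⟩
    have i1 : Integrable (fun x => g' x * φ x) (volume.restrict Ω) :=
      (Lp.memLp g').integrable_mul hφL
    have i2 : Integrable (fun x => g x * φ x) (volume.restrict Ω) :=
      (Lp.memLp g).integrable_mul hφL
    have e3 : ∫ x in Ω, φ x • (g' x - g x) = 0 := by
      have : (fun x => φ x • (g' x - g x)) = fun x => g' x * φ x - g x * φ x := by
        funext x; simp only [smul_eq_mul]; ring
      rw [this, integral_sub i1 i2, ← e1, ← e2, sub_self]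
    rw [← e3]
    refine (setIntegral_eq_integral_of_forall_compl_eq_zero ?_).symm
    intro x hx
    have : φ x = 0 := image_eq_zero_of_notMem_tsupport (fun h => hx (hs h))
    simp [this])
  refine Lp.ext ?_
  rw [Filter.EventuallyEq, ae_restrict_iff' hΩ.measurableSet]
  filter_upwards [key] with x hx hxΩ
  exact sub_eq_zero.1 (hx hxΩ)

/-- `‖Δw‖₂² + ‖Δz‖₂²`. -/
noncomputable def energy (Ω : Set (EuclideanSpace ℝ (Fin N))) (w z : L2 Ω) : ℝ :=
  ‖weakLaplacian Ω w‖ ^ 2 + ‖weakLaplacian Ω z‖ ^ 2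

/-- The best constant `S` in `‖w‖_r ≤ S ‖Δw‖₂`, `w ∈ W₀^{2,2}(Ω)`. -/
noncomputable def sobolevConst (Ω : Set (EuclideanSpace ℝ (Fin N))) (r : ℝ) : ℝ :=
  sInf {S : ℝ | 0 ≤ S ∧ ∀ w : L2 Ω, MemW0 Ω 2 w →
    eLpNorm w (ENNReal.ofReal r) (volume.restrict Ω) ≤ ENNReal.ofReal (S * ‖weakLaplacian Ω w‖)}

/-- `u ∈ C([0,T]; W₀^{2,2}(Ω)) ∩ L²(0,T; W^{4,2}(Ω)) ∩ W^{1,2}(0,T; L²(Ω))`, with time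
derivative `ut`. Here `W₀^{2,2}(Ω)` carries the norm `‖Δw‖₂`. -/
structure InSolutionSpace (Ω : Set (EuclideanSpace ℝ (Fin N))) (T : ℝ)
    (u ut : ℝ → L2 Ω) : Prop where
  mem_W0 : ∀ t ∈ Icc 0 T, MemW0 Ω 2 (u t)
  continuous_W0 : ContinuousOn (fun t => weakLaplacian Ω (u t)) (Icc 0 T)
  sq_integrable_W4 : ∃ D : (k : ℕ) → (Fin k → Fin N) → ℝ → L2 Ω,
    ∀ k ≤ 4, ∀ α : Fin k → Fin N, MemLp (D k α) 2 (volume.restrict (Ioo 0 T)) ∧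
      ∀ᵐ t ∂(volume.restrict (Ioo 0 T)), IsWeakDeriv Ω α (u t) (D k α t)
  sq_integrable_ut : MemLp ut 2 (volume.restrict (Ioo 0 T))
  eq_integral_ut : ∀ t ∈ Icc 0 T, u t = u 0 + ∫ s in (0 : ℝ)..t, ut s

/-- The coefficients and the source terms of the system
`u_t + δ₁(t) Δ²u - h₁(t) Δu = k₁(t) f₁(v)`, `v_t + δ₂(t) Δ²v - h₂(t) Δv = k₂(t) f₂(u)`. -/
structure SystemData where
  (δ₁ δ₂ h₁ h₂ k₁ k₂ : ℝ → ℝ)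
  (f₁ f₂ : ℝ → ℝ)

/-- The composition `f ∘ u` of a source term with `u` belongs to `L²(0,T; L²(Ω))`. -/
def SourceSqIntegrable (Ω : Set (EuclideanSpace ℝ (Fin N))) (T : ℝ) (f : ℝ → ℝ)
    (u : ℝ → L2 Ω) : Prop :=
  ∃ F : ℝ → L2 Ω, MemLp F 2 (volume.restrict (Ioo 0 T)) ∧
    ∀ᵐ t ∂(volume.restrict (Ioo 0 T)), ∀ᵐ x ∂(volume.restrict Ω), F t x = f (u t x)

/-- `w` solves `w_t + δ(t) Δ²w - h(t) Δw = k(t) f(z)` almost everywhere in `Ω × (0,T)`. -/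
def SolvesEquation (Ω : Set (EuclideanSpace ℝ (Fin N))) (T : ℝ) (δ h k f : ℝ → ℝ)
    (w wt z : ℝ → L2 Ω) : Prop :=
  ∀ᵐ t ∂(volume.restrict (Ioo 0 T)), ∀ᵐ x ∂(volume.restrict Ω),
    wt t x + δ t * weakLaplacian Ω (weakLaplacian Ω (w t)) x - h t * weakLaplacian Ω (w t) x
      = k t * f (z t x)

/-- `(u, v)` is a nonnegative solution on `[0,T]` of the system with clamped boundary conditions
(`u(t), v(t) ∈ W₀^{2,2}(Ω)`) and initial values `(u₀, v₀)`. -/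
def IsNonnegSolutionOn (Ω : Set (EuclideanSpace ℝ (Fin N))) (P : SystemData) (u₀ v₀ : L2 Ω)
    (T : ℝ) (u v : ℝ → L2 Ω) : Prop :=
  u 0 = u₀ ∧ v 0 = v₀ ∧
  (∀ t ∈ Icc 0 T, (∀ᵐ x ∂(volume.restrict Ω), 0 ≤ u t x) ∧
    ∀ᵐ x ∂(volume.restrict Ω), 0 ≤ v t x) ∧
  SourceSqIntegrable Ω T P.f₁ v ∧ SourceSqIntegrable Ω T P.f₂ u ∧
  ∃ ut vt : ℝ → L2 Ω, InSolutionSpace Ω T u ut ∧ InSolutionSpace Ω T v vt ∧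
    SolvesEquation Ω T P.δ₁ P.h₁ P.k₁ P.f₁ u ut v ∧
    SolvesEquation Ω T P.δ₂ P.h₂ P.k₂ P.f₂ v vt u

/-- `sup_{0 < t < τ} g(t)`. -/
noncomputable def supOn (τ : ℝ) (g : ℝ → ℝ) : ℝ := sSup (g '' Ioo 0 τ)

/-- Weight functions `ε₁, …, ε₄` on `(0,τ)`: positive, balancing the diffusion coefficients, and
such that the suprema in the constants `A`, `Ã`, `B` below are finite. -/
structure IsWeight (P : SystemData) (τ : ℝ) (ε₁ ε₂ ε₃ ε₄ : ℝ → ℝ) : Prop where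
  pos : ∀ t ∈ Ioo 0 τ, 0 < ε₁ t ∧ 0 < ε₂ t ∧ 0 < ε₃ t ∧ 0 < ε₄ t
  balance₁ : ∀ t ∈ Ioo 0 τ, P.h₁ t / ε₂ t + P.k₁ t / ε₁ t = 2 * P.δ₁ t
  balance₂ : ∀ t ∈ Ioo 0 τ, P.h₂ t / ε₄ t + P.k₂ t / ε₃ t = 2 * P.δ₂ t
  bdd₁ : BddAbove ((fun t => P.k₁ t * ε₁ t) '' Ioo 0 τ)
  bdd₂ : BddAbove ((fun t => P.h₁ t * ε₂ t) '' Ioo 0 τ)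
  bdd₃ : BddAbove ((fun t => P.k₂ t * ε₃ t) '' Ioo 0 τ)
  bdd₄ : BddAbove ((fun t => P.h₂ t * ε₄ t) '' Ioo 0 τ)

/-- `B = max {sup h₁ ε₂, sup h₂ ε₄}`. -/
noncomputable def constB (P : SystemData) (τ : ℝ) (ε₂ ε₄ : ℝ → ℝ) : ℝ :=
  max (supOn τ fun t => P.h₁ t * ε₂ t) (supOn τ fun t => P.h₂ t * ε₄ t)

/-- `A = max {sup k₂ ε₃ S_{2q}^{2q} Φ₀^{q-p}, sup k₁ ε₁ S_{2p}^{2p}}`. -/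
noncomputable def constA (Ω : Set (EuclideanSpace ℝ (Fin N))) (P : SystemData) (τ p q Φ₀ : ℝ)
    (ε₁ ε₃ : ℝ → ℝ) : ℝ :=
  max (supOn τ fun t => P.k₂ t * ε₃ t * sobolevConst Ω (2 * q) ^ (2 * q) * Φ₀ ^ (q - p))
    (supOn τ fun t => P.k₁ t * ε₁ t * sobolevConst Ω (2 * p) ^ (2 * p))

/-- `Ã = S_{2p}^{2p} max {sup k₂ ε₃, sup k₁ ε₁}`. -/
noncomputable def constATilde (Ω : Set (EuclideanSpace ℝ (Fin N))) (P : SystemData) (τ p : ℝ)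
    (ε₁ ε₃ : ℝ → ℝ) : ℝ :=
  sobolevConst Ω (2 * p) ^ (2 * p) *
    max (supOn τ fun t => P.k₂ t * ε₃ t) (supOn τ fun t => P.k₁ t * ε₁ t)

/-- `T = (1 / (B (p - 1))) ln [1 + (B / C) Φ₀^{1-p}]`, with `C = 2A` if `p > q` and `C = Ã` if
`p = q`. -/
noncomputable def lowerTime (Ω : Set (EuclideanSpace ℝ (Fin N))) (P : SystemData)
    (τ p q Φ₀ : ℝ) (ε₁ ε₂ ε₃ ε₄ : ℝ → ℝ) : ℝ :=
  1 / (constB P τ ε₂ ε₄ * (p - 1)) *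
    Real.log (1 + constB P τ ε₂ ε₄ /
      (if q < p then 2 * constA Ω P τ p q Φ₀ ε₁ ε₃ else constATilde Ω P τ p ε₁ ε₃) *
        Φ₀ ^ (1 - p))

end FourthOrder

/-! Test the equation for u with Δ²u. The derivative of ‖Δu‖² is 2⟪Δ²u, u_t⟫, and Young's inequality
with the weights ε₁, ε₂ bounds the two cross terms; the balance condition makes the multiples of
‖Δ²u‖² so produced cancel exactly against the dissipation. What remains is h₁ε₂‖Δu‖² + k₁ε₁‖f₁(v)‖²,
and the Sobolev inequality bounds ‖f₁(v)‖² by a multiple of ‖Δv‖^{2p}. With a = ‖Δu‖², b = ‖Δv‖², c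
= Φ₀ and K = A or Ã, the two equations give, in integrated form, a' ≤ Ba + Kb^p and b' ≤ Bb +
Kc^{p-q}a^q (`energy_inequality`). This rests on a chain rule valid at the given regularity
(`norm_sq_sub_norm_sq_eq_integral`) and on ‖D²φ‖₂ = ‖Δφ‖₂ for test functions.

Let R be c plus the integral of the sum of the two right-hand sides. Then a + b ≤ R, and R ≥ c even
if Φ itself drops below Φ₀, so that c^{p-q}a^q ≤ R^p. Hence R' ≤ BR + CR^p, with C = 2K if q < p and
C = K if q = p. The Bernoulli equation with this right-hand side and initial value c blows up
exactly at time T.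

The delicate case is t* = T, where this comparison alone would still allow R to blow up. It is
excluded because R cannot solve the Bernoulli equation exactly (`eq_of_growth_eq`): equality forces
q = p, R = a + b and ab = 0. By continuity the same one of a, b vanishes throughout, so the survivor
has lost its source and grows at most at the linear rate B, too slowly for R. The resulting strict
gain persists up to T (`bounded_of_bernoulli`). -/

namespace FourthOrder

open scoped RealInnerProductSpace

/-! ### Test functions and the identity ‖D²φ‖₂ = ‖Δφ‖₂ -/

section TestFunctions

variable {N : ℕ} {Ω : Set (EuclideanSpace ℝ (Fin N))} {φ ψ : EuclideanSpace ℝ (Fin N) → ℝ}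

theorem partialDeriv_zero (α : Fin 0 → Fin N) (φ : EuclideanSpace ℝ (Fin N) → ℝ) :
    partialDeriv α φ = φ := by
  funext x
  simp [partialDeriv]

theorem partialDeriv_succ (hφ : ContDiff ℝ ∞ φ) {k : ℕ} (α : Fin (k + 1) → Fin N)
    (x : EuclideanSpace ℝ (Fin N)) :
    partialDeriv α φ x =
      fderiv ℝ (partialDeriv (Fin.tail α) φ) x (EuclideanSpace.single (α 0) 1) := by
  have h : DifferentiableAt ℝ (iteratedFDeriv ℝ k φ) x :=
    (hφ.differentiable_iteratedFDeriv (by exact_mod_cast ENat.natCast_lt_top k)) x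
  exact h.iteratedFDeriv_succ_apply_left'

/-- The classical first order partial derivative. -/
noncomputable def pd (i : Fin N) (φ : EuclideanSpace ℝ (Fin N) → ℝ)
    (x : EuclideanSpace ℝ (Fin N)) : ℝ :=
  fderiv ℝ φ x (EuclideanSpace.single i 1)

theorem IsTest.pd (hφ : IsTest Ω φ) (i : Fin N) : IsTest Ω (pd i φ) where
  smooth := (hφ.smooth.fderiv_right (m := ∞) (by simp)).clm_apply contDiff_const
  compact := hφ.compact.fderiv_apply ℝ _
  supp := (tsupport_fderiv_apply_subset ℝ _).trans hφ.supp

theorem partialDeriv_cons (hφ : ContDiff ℝ ∞ φ) {k : ℕ} (i : Fin N) (α : Fin k → Fin N) :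
    partialDeriv (Matrix.vecCons i α) φ = pd i (partialDeriv α φ) := by
  funext x
  rw [partialDeriv_succ hφ]; rfl

theorem IsTest.partialDeriv (hφ : IsTest Ω φ) :
    ∀ {k : ℕ} (α : Fin k → Fin N), IsTest Ω (partialDeriv α φ)
  | 0, α => by rwa [partialDeriv_zero]
  | k + 1, α => by
    have : FourthOrder.partialDeriv α φ =
        FourthOrder.pd (α 0) (FourthOrder.partialDeriv (Fin.tail α) φ) := by
      funext x
      rw [partialDeriv_succ hφ.smooth]; rfl
    rw [this]
    exact (hφ.partialDeriv _).pd _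

theorem partialDeriv_pair (hφ : ContDiff ℝ ∞ φ) (i j : Fin N) :
    partialDeriv ![i, j] φ = pd i (pd j φ) := by
  rw [partialDeriv_cons hφ, partialDeriv_cons hφ, partialDeriv_zero]

theorem IsTest.add (hφ : IsTest Ω φ) (hψ : IsTest Ω ψ) : IsTest Ω (fun x => φ x + ψ x) where
  smooth := hφ.smooth.add hψ.smooth
  compact := hφ.compact.add hψ.compact
  supp := (tsupport_add _ _).trans (union_subset hφ.supp hψ.supp)

theorem isTest_zero : IsTest Ω (fun _ => 0) where
  smooth := contDiff_const
  compact := HasCompactSupport.zero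
  supp := by
    have : tsupport (fun _ : EuclideanSpace ℝ (Fin N) => (0 : ℝ)) = ∅ := tsupport_eq_empty_iff.2 rfl
    rw [this]; exact empty_subset _

theorem IsTest.sum {ι : Type*} (s : Finset ι) {f : ι → EuclideanSpace ℝ (Fin N) → ℝ}
    (h : ∀ i ∈ s, IsTest Ω (f i)) : IsTest Ω (fun x => ∑ i ∈ s, f i x) := by
  classical
  induction s using Finset.induction_on with
  | empty => simpa using isTest_zero
  | insert a s ha ih =>
    simp only [Finset.sum_insert ha]
    exact (h a (Finset.mem_insert_self _ _)).add
      (ih fun i hi => h i (Finset.mem_insert_of_mem hi))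

theorem laplacian_eq_sum (φ : EuclideanSpace ℝ (Fin N) → ℝ) (x : EuclideanSpace ℝ (Fin N)) :
    Laplacian.laplacian φ x = ∑ i, partialDeriv ![i, i] φ x := by
  rw [InnerProductSpace.laplacian_eq_iteratedFDeriv_orthonormalBasis φ
    (EuclideanSpace.basisFun (Fin N) ℝ)]
  refine Finset.sum_congr rfl fun i _ => ?_
  unfold partialDeriv
  congr 1
  funext j
  fin_cases j <;> simp

theorem IsTest.laplacian (hφ : IsTest Ω φ) : IsTest Ω (Laplacian.laplacian φ) := by
  have : Laplacian.laplacian φ = fun x => ∑ i, FourthOrder.partialDeriv ![i, i] φ x :=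
    funext (laplacian_eq_sum φ)
  rw [this]
  exact IsTest.sum _ fun i _ => hφ.partialDeriv _

theorem IsTest.eq_zero (hφ : IsTest Ω φ) {x : EuclideanSpace ℝ (Fin N)} (hx : x ∉ Ω) : φ x = 0 :=
  image_eq_zero_of_notMem_tsupport fun h => hx (hφ.supp h)

theorem IsTest.memLp (hφ : IsTest Ω φ) (r : ℝ≥0∞) (μ : Measure (EuclideanSpace ℝ (Fin N)))
    [IsFiniteMeasureOnCompacts μ] : MemLp φ r μ :=
  hφ.smooth.continuous.memLp_of_hasCompactSupport hφ.compact

theorem IsTest.integrable_mul (hφ : IsTest Ω φ) (hψ : IsTest Ω ψ) :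
    Integrable (fun x => φ x * ψ x) :=
  (hφ.memLp 2 volume).integrable_mul (hψ.memLp 2 volume)

theorem integral_mul_pd (hφ : IsTest Ω φ) (hψ : IsTest Ω ψ) (i : Fin N) :
    ∫ x, φ x * pd i ψ x = - ∫ x, pd i φ x * ψ x :=
  integral_mul_fderiv_eq_neg_fderiv_mul_of_integrable ((hφ.pd i).integrable_mul hψ)
    (hφ.integrable_mul (hψ.pd i)) (hφ.integrable_mul hψ)
    (fun _ _ => (hφ.smooth.differentiable (by simp)) _)
    (fun _ _ => (hψ.smooth.differentiable (by simp)) _)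

theorem pd_comm (hφ : ContDiff ℝ ∞ φ) (i j : Fin N) : pd i (pd j φ) = pd j (pd i φ) := by
  funext x
  have hd : DifferentiableAt ℝ (fderiv ℝ φ) x :=
    (hφ.fderiv_right (m := ∞) (by simp)).differentiable (by simp) x
  have h : ∀ a b : Fin N, pd a (pd b φ) x =
      fderiv ℝ (fderiv ℝ φ) x (EuclideanSpace.single a 1) (EuclideanSpace.single b 1) := by
    intro a b
    unfold pd
    rw [fderiv_clm_apply hd (differentiableAt_const _)]
    simp
  rw [h, h]
  exact (hφ.contDiffAt.isSymmSndFDerivAt (by simpa using ENat.LEInfty.out)) _ _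

/-- Integrate by parts once in direction i and once in direction j; the signs cancel and compact
support leaves no boundary terms. Summing over i, j turns the right side into ∫ (Δφ)². -/
theorem integral_sq_pd_pd (hφ : IsTest Ω φ) (i j : Fin N) :
    ∫ x, pd i (pd j φ) x ^ 2 = ∫ x, pd i (pd i φ) x * pd j (pd j φ) x := by
  calc ∫ x, pd i (pd j φ) x ^ 2 = ∫ x, pd i (pd j φ) x * pd i (pd j φ) x := by simp only [sq]
    _ = - ∫ x, pd i (pd i (pd j φ)) x * pd j φ x := integral_mul_pd ((hφ.pd j).pd i) (hφ.pd j) i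
    _ = - ∫ x, pd j φ x * pd j (pd i (pd i φ)) x := by
        rw [pd_comm hφ.smooth i j, pd_comm (hφ.pd i).smooth i j]
        simp only [mul_comm]
    _ = ∫ x, pd j (pd j φ) x * pd i (pd i φ) x := by
        rw [integral_mul_pd (hφ.pd j) ((hφ.pd i).pd i) j, neg_neg]
    _ = _ := by simp only [mul_comm]

theorem laplacian_eq_sum_pd (hφ : IsTest Ω φ) (x : EuclideanSpace ℝ (Fin N)) :
    Laplacian.laplacian φ x = ∑ i, pd i (pd i φ) x := by
  rw [laplacian_eq_sum]
  simp only [partialDeriv_pair hφ.smooth]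

theorem sum_integral_sq_pd_pd (hφ : IsTest Ω φ) :
    ∑ i, ∑ j, ∫ x, pd i (pd j φ) x ^ 2 = ∫ x, Laplacian.laplacian φ x ^ 2 := by
  simp only [laplacian_eq_sum_pd hφ, sq (∑ i, _), Finset.sum_mul_sum, integral_sq_pd_pd hφ]
  have hint : ∀ i j, Integrable (fun x => pd i (pd i φ) x * pd j (pd j φ) x) := fun i j =>
    ((hφ.pd i).pd i).integrable_mul ((hφ.pd j).pd j)
  rw [integral_finsetSum _ fun i _ => integrable_finsetSum _ fun j _ => hint i j]
  exact Finset.sum_congr rfl fun i _ => (integral_finsetSum _ fun j _ => hint i j).symm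

theorem eLpNorm_pd_pd_le (hφ : IsTest Ω φ) (i j : Fin N) :
    eLpNorm (pd i (pd j φ)) 2 volume ≤ eLpNorm (Laplacian.laplacian φ) 2 volume := by
  rw [(((hφ.pd j).pd i).memLp 2 volume).eLpNorm_eq_integral_rpow_norm (by simp) (by simp),
    (hφ.laplacian.memLp 2 volume).eLpNorm_eq_integral_rpow_norm (by simp) (by simp)]
  refine ENNReal.ofReal_le_ofReal ?_
  simp only [ENNReal.toReal_ofNat, Real.rpow_ofNat, Real.norm_eq_abs, sq_abs]
  refine Real.rpow_le_rpow (by positivity) ?_ (by norm_num)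
  rw [← sum_integral_sq_pd_pd hφ]
  have h : ∀ i j, 0 ≤ ∫ x, pd i (pd j φ) x ^ 2 := fun i j => integral_nonneg fun x => sq_nonneg _
  exact (Finset.single_le_sum (f := fun j => ∫ x, pd i (pd j φ) x ^ 2) (fun j _ => h i j)
    (Finset.mem_univ j)).trans (Finset.single_le_sum (f := fun i => ∑ j, ∫ x, pd i (pd j φ) x ^ 2)
      (fun i _ => Finset.sum_nonneg fun j _ => h i j) (Finset.mem_univ i))

end TestFunctions

/-! ### The second order Sobolev inequality for test functions -/

section Sobolev

variable {N : ℕ} {Ω : Set (EuclideanSpace ℝ (Fin N))}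

theorem norm_le_sum_apply_single (L : EuclideanSpace ℝ (Fin N) →L[ℝ] ℝ) :
    ‖L‖ ≤ ∑ i, ‖L (EuclideanSpace.single i 1)‖ := by
  refine L.opNorm_le_bound (Finset.sum_nonneg fun i _ => norm_nonneg _) fun x => ?_
  have hx : x = ∑ i, x i • EuclideanSpace.single i (1 : ℝ) := by
    simpa using ((EuclideanSpace.basisFun (Fin N) ℝ).sum_repr x).symm
  calc ‖L x‖ = ‖∑ i, x i • L (EuclideanSpace.single i 1)‖ := by
        conv_lhs => rw [hx]
        simp only [map_sum, map_smul]
    _ ≤ ∑ i, ‖x i • L (EuclideanSpace.single i 1)‖ := norm_sum_le _ _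
    _ ≤ ∑ i, ‖L (EuclideanSpace.single i 1)‖ * ‖x‖ := by
        refine Finset.sum_le_sum fun i _ => ?_
        rw [norm_smul, mul_comm]
        exact mul_le_mul_of_nonneg_left (PiLp.norm_apply_le x i) (norm_nonneg _)
    _ = _ := by rw [Finset.sum_mul]

theorem eLpNorm_le_sum_eLpNorm_pd (hΩ : Bornology.IsBounded Ω) {r s : NNReal} (hr : 1 ≤ r)
    (hrN : r < N) (hrs : (r : ℝ)⁻¹ - (N : ℝ)⁻¹ ≤ (s : ℝ)⁻¹) :
    ∃ C : NNReal, ∀ φ, IsTest Ω φ →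
      eLpNorm φ s volume ≤ C * ∑ i, eLpNorm (pd i φ) r volume := by
  refine ⟨eLpNormLESNormFDerivOfLeConst ℝ volume Ω r s, fun φ hφ => ?_⟩
  have hdim : Module.finrank ℝ (EuclideanSpace ℝ (Fin N)) = N := by simp
  refine (eLpNorm_le_eLpNorm_fderiv_of_le volume (hφ.smooth.of_le (by exact_mod_cast le_top))
    ((subset_tsupport φ).trans hφ.supp) hr (by rw [hdim]; exact_mod_cast hrN)
    (by rw [hdim]; exact hrs) hΩ).trans ?_
  gcongr
  have hmeas : ∀ i ∈ (Finset.univ : Finset (Fin N)),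
      AEStronglyMeasurable (fun x => ‖pd i φ x‖) volume := fun i _ =>
    (hφ.pd i).smooth.continuous.norm.aestronglyMeasurable
  calc eLpNorm (fderiv ℝ φ) r volume ≤ eLpNorm (∑ i, fun x => ‖pd i φ x‖) r volume := by
        refine eLpNorm_mono fun x => ?_
        rw [Finset.sum_apply]
        exact (norm_le_sum_apply_single _).trans (le_abs_self _)
    _ ≤ ∑ i, eLpNorm (fun x => ‖pd i φ x‖) r volume :=
        eLpNorm_sum_le hmeas (by exact_mod_cast hr)
    _ = _ := by simp only [eLpNorm_norm]

theorem IsTest.eLpNorm_restrict {φ : EuclideanSpace ℝ (Fin N) → ℝ} (hφ : IsTest Ω φ)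
    (r : ℝ≥0∞) : eLpNorm φ r (volume.restrict Ω) = eLpNorm φ r volume :=
  eLpNorm_restrict_eq_of_support_subset ((subset_tsupport φ).trans hφ.supp)

/-- On test functions in a bounded set the `L²` norm controls the `Lˢ` norm for `s ≤ 2`. -/
theorem eLpNorm_le_eLpNorm_two (hΩ : Bornology.IsBounded Ω) {s : NNReal} (hs : s ≤ 2) :
    ∃ C : NNReal, ∀ φ, IsTest Ω φ → eLpNorm φ s volume ≤ C * eLpNorm φ 2 volume := by
  have hfin : volume Ω ≠ ⊤ := hΩ.measure_lt_top.ne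
  by_cases h0 : s = 0
  · exact ⟨0, fun φ _ => by simp [h0]⟩
  have hexp : 0 ≤ 1 / (s : ℝ≥0∞).toReal - 1 / (2 : ℝ≥0∞).toReal := by
    have hs' : (s : ℝ) ≤ 2 := by exact_mod_cast hs
    have hpos : (0 : ℝ) < s := by positivity
    simp only [ENNReal.coe_toReal, ENNReal.toReal_ofNat, sub_nonneg]
    gcongr
  refine ⟨((volume Ω) ^ (1 / (s : ℝ≥0∞).toReal - 1 / (2 : ℝ≥0∞).toReal)).toNNReal,
    fun φ hφ => ?_⟩
  rw [← hφ.eLpNorm_restrict, ← hφ.eLpNorm_restrict, ENNReal.coe_toNNReal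
    (ENNReal.rpow_ne_top_of_nonneg hexp hfin), mul_comm]
  have := eLpNorm_le_eLpNorm_mul_rpow_measure_univ (μ := volume.restrict Ω) (f := φ)
    (p := s) (q := 2) (by exact_mod_cast hs) hφ.smooth.continuous.aestronglyMeasurable
  simpa using this

/-- The Sobolev inequality `‖φ‖_ρ ≤ C ‖Δφ‖₂` for test functions in a bounded set. -/
theorem exists_eLpNorm_le_laplacian (hN : 2 ≤ N) (hΩ : Bornology.IsBounded Ω) {ρ : ℝ} (hρ : 2 < ρ)
    (hρN : 4 < N → ρ < 2 * (N : ℝ) / ((N : ℝ) - 4)) :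
    ∃ C : NNReal, ∀ φ, IsTest Ω φ →
      eLpNorm φ (ENNReal.ofReal ρ) volume ≤ C * eLpNorm (Laplacian.laplacian φ) 2 volume := by
  have hN' : (2 : ℝ) ≤ N := by exact_mod_cast hN
  have hρ0 : (0 : ℝ) < ρ := by linarith
  have hNinv : (N : ℝ)⁻¹ ≤ 1 / 2 := by
    rw [inv_le_comm₀ (by linarith) (by norm_num)]; linarith
  have hNpos : 0 < (N : ℝ)⁻¹ := by positivity
  have hρinv : ρ⁻¹ < 1 / 2 := by
    rw [inv_lt_comm₀ hρ0 (by norm_num)]; linarith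
  have hρpos : 0 < ρ⁻¹ := by positivity
  -- The first order inequality is applied twice, from Lˢ to Lʳ and from Lʳ to L^ρ, with 1/r = 1/N +
  -- 1/ρ. It needs s < N, so s = 2 serves for N ≥ 3, while N = 2 forces s < 2 and s = 1 is taken; L²
  -- controls Lˢ because Ω is bounded.
  obtain ⟨s, hs1, hs2, hsN, hsρ⟩ : ∃ s : NNReal, 1 ≤ s ∧ s ≤ 2 ∧ (s : ℝ) < N ∧
      (s : ℝ)⁻¹ - (N : ℝ)⁻¹ ≤ (N : ℝ)⁻¹ + ρ⁻¹ := by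
    rcases hN.eq_or_lt with rfl | h3
    · exact ⟨1, le_rfl, one_le_two, by norm_num, by norm_num; linarith⟩
    · have h3' : (3 : ℝ) ≤ N := by exact_mod_cast h3
      refine ⟨2, one_le_two, le_rfl, by norm_num; linarith, ?_⟩
      norm_num
      rcases le_or_gt N 4 with h4 | h4
      · have h4' : (N : ℝ) ≤ 4 := by exact_mod_cast h4
        have : (1 / 4 : ℝ) ≤ (N : ℝ)⁻¹ := by
          rw [le_inv_comm₀ (by norm_num) (by linarith)]; linarith
        linarith
      · have h4' : (4 : ℝ) < N := by exact_mod_cast h4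
        have h := hρN h4
        rw [lt_div_iff₀ (by linarith)] at h
        -- This is the subcritical bound on ρ, rewritten for reciprocals.
        have e : 1 / 2 - 2 * (N : ℝ)⁻¹ ≤ ρ⁻¹ := by
          have : 1 / 2 - 2 * (N : ℝ)⁻¹ = (N - 4) / (2 * N) := by field_simp; ring
          rw [this, div_le_iff₀ (by linarith), ← div_eq_inv_mul, le_div_iff₀ hρ0]
          linarith
        linarith
  obtain ⟨r, hr⟩ : ∃ r : NNReal, (r : ℝ)⁻¹ = (N : ℝ)⁻¹ + ρ⁻¹ :=
    ⟨(((N : ℝ)⁻¹ + ρ⁻¹)⁻¹).toNNReal, by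
      rw [Real.coe_toNNReal _ (by positivity), inv_inv]⟩
  have hr0 : (0 : ℝ) < r := by
    have : (0 : ℝ) < (r : ℝ)⁻¹ := by rw [hr]; positivity
    exact inv_pos.1 this
  have hr1 : (1 : ℝ) ≤ r := by
    rw [← inv_le_one₀ hr0]; linarith
  have hrN : (r : ℝ) < N := by
    rw [← inv_lt_inv₀ (by linarith) hr0]; linarith
  obtain ⟨C₁, h₁⟩ := eLpNorm_le_sum_eLpNorm_pd (Ω := Ω) hΩ (r := r) (s := ρ.toNNReal)
    (by exact_mod_cast hr1) (by exact_mod_cast hrN)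
    (by rw [Real.coe_toNNReal _ hρ0.le, hr]; linarith)
  obtain ⟨C₂, h₂⟩ := eLpNorm_le_sum_eLpNorm_pd (Ω := Ω) hΩ (r := s) (s := r) hs1
    (by exact_mod_cast hsN) (by rw [hr]; exact hsρ)
  obtain ⟨C₃, h₃⟩ := eLpNorm_le_eLpNorm_two (Ω := Ω) hΩ hs2
  refine ⟨C₁ * (N * (C₂ * (N * C₃))), fun φ hφ => ?_⟩
  calc eLpNorm φ (ENNReal.ofReal ρ) volume ≤ C₁ * ∑ i, eLpNorm (pd i φ) r volume := h₁ φ hφ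
    _ ≤ C₁ * ∑ i : Fin N, C₂ * ∑ j : Fin N,
          C₃ * eLpNorm (Laplacian.laplacian φ) 2 volume := by
        gcongr with i _
        refine (h₂ _ (hφ.pd i)).trans ?_
        gcongr with j _
        refine (h₃ _ ((hφ.pd i).pd j)).trans ?_
        gcongr
        exact eLpNorm_pd_pd_le hφ j i
    _ = _ := by
        simp only [Finset.sum_const, Finset.card_univ, Fintype.card_fin, nsmul_eq_mul]
        push_cast
        ring

end Sobolev

/-! ### Weak Laplacians, Green's formula and the Sobolev constant on W₀^{2,2}(Ω) -/

section WeakLaplacian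

variable {N : ℕ} {Ω : Set (EuclideanSpace ℝ (Fin N))} {φ ψ : EuclideanSpace ℝ (Fin N) → ℝ}

/-- A test function as an element of `L²(Ω)`. -/
noncomputable def IsTest.toL2 (hφ : IsTest Ω φ) : L2 Ω :=
  (hφ.memLp 2 (volume.restrict Ω)).toLp φ

theorem IsTest.coeFn_toL2 (hφ : IsTest Ω φ) : hφ.toL2 =ᵐ[volume.restrict Ω] φ :=
  MemLp.coeFn_toLp _

theorem integral_mul_eq_inner (w : L2 Ω) (hφ : IsTest Ω φ) :
    ∫ x in Ω, w x * φ x = ⟪w, hφ.toL2⟫ := by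
  rw [L2.inner_def]
  refine integral_congr_ae ?_
  filter_upwards [hφ.coeFn_toL2] with x hx
  simp [hx, mul_comm]

theorem IsTest.toL2_congr (hφ : IsTest Ω φ) (hψ : IsTest Ω ψ) (h : φ = ψ) :
    hφ.toL2 = hψ.toL2 := by
  subst h; rfl

theorem IsTest.toL2_sum {ι : Type*} (s : Finset ι) {f : ι → EuclideanSpace ℝ (Fin N) → ℝ}
    (h : ∀ i, IsTest Ω (f i)) (hφ : IsTest Ω φ) (e : ∀ x, φ x = ∑ i ∈ s, f i x) :
    hφ.toL2 = ∑ i ∈ s, (h i).toL2 := by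
  refine Lp.ext ?_
  have h1 : ∀ᵐ x ∂(volume.restrict Ω), ∀ i ∈ s, (h i).toL2 x = f i x :=
    (ae_ball_iff s.countable_toSet).2 fun i _ => (h i).coeFn_toL2
  filter_upwards [hφ.coeFn_toL2, Lp.coeFn_finsetSum s fun i => (h i).toL2, h1] with x hx hs h1
  rw [hx, hs, e, Finset.sum_apply]
  exact Finset.sum_congr rfl fun i hi => (h1 i hi).symm

theorem IsTest.toL2_laplacian (hφ : IsTest Ω φ) :
    hφ.laplacian.toL2 = ∑ i, (hφ.partialDeriv ![i, i]).toL2 :=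
  IsTest.toL2_sum _ _ _ (laplacian_eq_sum φ)

theorem pd_sum {ι : Type*} (s : Finset ι) {f : ι → EuclideanSpace ℝ (Fin N) → ℝ}
    (h : ∀ i, IsTest Ω (f i)) (i : Fin N) :
    pd i (fun x => ∑ j ∈ s, f j x) = fun x => ∑ j ∈ s, pd i (f j) x := by
  funext x
  unfold pd
  rw [fderiv_fun_sum fun j _ => (h j).smooth.differentiable (by simp) x]
  simp

theorem IsTest.toL2_laplacian_laplacian (hφ : IsTest Ω φ) :
    hφ.laplacian.laplacian.toL2 = ∑ i, ∑ j, (hφ.partialDeriv ![i, i, j, j]).toL2 := by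
  rw [hφ.laplacian.toL2_laplacian]
  refine Finset.sum_congr rfl fun i _ => IsTest.toL2_sum _ _ _ fun x => ?_
  have e : Laplacian.laplacian φ = fun x => ∑ j, FourthOrder.partialDeriv ![j, j] φ x :=
    funext (laplacian_eq_sum φ)
  rw [partialDeriv_pair hφ.laplacian.smooth, e, pd_sum (Ω := Ω) _ fun j => hφ.partialDeriv _,
    pd_sum (Ω := Ω) _ fun j => (hφ.partialDeriv _).pd _]
  simp only [partialDeriv_cons hφ.smooth]

theorem isWeakLaplacian_iff {w g : L2 Ω} : IsWeakLaplacian Ω w g ↔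
    ∀ (φ : EuclideanSpace ℝ (Fin N) → ℝ) (hφ : IsTest Ω φ),
      ⟪w, hφ.laplacian.toL2⟫ = ⟪g, hφ.toL2⟫ := by
  unfold IsWeakLaplacian
  refine forall_congr' fun φ => forall_congr' fun hφ => ?_
  rw [integral_mul_eq_inner _ hφ, integral_mul_eq_inner _ hφ.laplacian]

theorem IsWeakDeriv.inner_eq {k : ℕ} {α : Fin k → Fin N} {w g : L2 Ω} (h : IsWeakDeriv Ω α w g)
    (hφ : IsTest Ω φ) : ⟪w, (hφ.partialDeriv α).toL2⟫ = (-1) ^ k * ⟪g, hφ.toL2⟫ := by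
  rw [← integral_mul_eq_inner, ← integral_mul_eq_inner]
  exact h φ hφ

theorem IsWeakDeriv.isWeakLaplacian {w : L2 Ω} {G : Fin N → L2 Ω}
    (h : ∀ i, IsWeakDeriv Ω ![i, i] w (G i)) : IsWeakLaplacian Ω w (∑ i, G i) := by
  rw [isWeakLaplacian_iff]
  intro φ hφ
  rw [hφ.toL2_laplacian, inner_sum, sum_inner]
  refine Finset.sum_congr rfl fun i _ => ?_
  simp [(h i).inner_eq hφ]

/-- Two functions of `L²(Ω)` agree if they agree as distributions. -/
theorem eq_of_forall_inner_test (hΩ : IsOpen Ω) {g g' : L2 Ω}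
    (h : ∀ (φ : EuclideanSpace ℝ (Fin N) → ℝ) (hφ : IsTest Ω φ),
      ⟪g, hφ.toL2⟫ = ⟪g', hφ.toL2⟫) : g = g' := by
  have hloc : LocallyIntegrableOn (fun x => g x - g' x) Ω :=
    locallyIntegrableOn_of_locallyIntegrable_restrict
      (((Lp.memLp g).sub (Lp.memLp g')).locallyIntegrable (by norm_num))
  have key := hΩ.ae_eq_zero_of_integral_contDiff_smul_eq_zero hloc (by
    intro φ hφ hc hs
    have ht : IsTest Ω φ := ⟨hφ, hc, hs⟩
    have e := h φ ht
    have hi : ∀ w : L2 Ω, Integrable (fun x => w x * φ x) (volume.restrict Ω) := fun w =>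
      (Lp.memLp w).integrable_mul (ht.memLp 2 _)
    rw [← integral_mul_eq_inner, ← integral_mul_eq_inner, ← sub_eq_zero,
      ← integral_sub (hi g) (hi g')] at e
    rw [← e, ← setIntegral_eq_integral_of_forall_compl_eq_zero (s := Ω)
      fun x hx => by simp [ht.eq_zero hx]]
    exact integral_congr_ae (Eventually.of_forall fun x => by simp only [smul_eq_mul]; ring))
  refine Lp.ext ?_
  rw [Filter.EventuallyEq, ae_restrict_iff' hΩ.measurableSet]
  filter_upwards [key] with x hx hxΩ
  exact sub_eq_zero.1 (hx hxΩ)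

theorem MemW0.isWeakLaplacian (hΩ : IsOpen Ω) {w : L2 Ω} (hw : MemW0 Ω 2 w) :
    IsWeakLaplacian Ω w (weakLaplacian Ω w) := by
  obtain ⟨G, hG, -⟩ := hw
  have h := IsWeakDeriv.isWeakLaplacian fun i => hG 2 le_rfl ![i, i]
  rwa [h.eq_weakLaplacian hΩ]

/-- A function of `W₀^{2,2}(Ω)` is the limit of test functions, together with its Laplacian. -/
theorem MemW0.exists_seq (hΩ : IsOpen Ω) {w : L2 Ω} (hw : MemW0 Ω 2 w) :
    ∃ (φ : ℕ → EuclideanSpace ℝ (Fin N) → ℝ) (h : ∀ n, IsTest Ω (φ n)),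
      Tendsto (fun n => (h n).toL2) atTop (𝓝 w) ∧
      Tendsto (fun n => (h n).laplacian.toL2) atTop (𝓝 (weakLaplacian Ω w)) := by
  obtain ⟨G, hG, happ⟩ := hw
  have h2 := IsWeakDeriv.isWeakLaplacian fun i => hG 2 le_rfl ![i, i]
  -- The approximation is stated for the derivatives `G` only; that order zero gives w back follows
  -- from uniqueness of distributions.
  have h0 : G 0 ![] = w := by
    refine eq_of_forall_inner_test hΩ fun φ hφ => ?_
    have := (hG 0 (by norm_num) ![]).inner_eq hφ
    rw [pow_zero, one_mul] at this
    rw [← this]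
    congr 1
  choose φ hφ hlim using fun n : ℕ => happ (1 / ((n : ℝ) + 1)) Nat.one_div_pos_of_nat
  have hconv : ∀ k ≤ 2, ∀ α : Fin k → Fin N,
      Tendsto (fun n => ((hφ n).partialDeriv α).toL2) atTop (𝓝 (G k α)) := by
    intro k hk α
    rw [Lp.tendsto_Lp_iff_tendsto_eLpNorm']
    have hz : Tendsto (fun n : ℕ => ENNReal.ofReal (1 / ((n : ℝ) + 1))) atTop (𝓝 0) := by
      simpa using ENNReal.tendsto_ofReal tendsto_one_div_add_atTop_nhds_zero_nat
    refine tendsto_of_tendsto_of_tendsto_of_le_of_le tendsto_const_nhds hz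
      (fun n => zero_le) fun n => ?_
    refine (eLpNorm_congr_ae ?_).trans_le (hlim n k hk α)
    filter_upwards [((hφ n).partialDeriv α).coeFn_toL2] with x hx
    simp [hx]
  refine ⟨φ, hφ, ?_, ?_⟩
  · rw [← h0]
    refine (hconv 0 (by norm_num) ![]).congr fun n => ?_
    exact IsTest.toL2_congr _ _ (partialDeriv_zero _ _)
  · rw [h2.eq_weakLaplacian hΩ]
    exact (tendsto_finsetSum _ fun i _ => hconv 2 le_rfl _).congr
      fun n => (hφ n).toL2_laplacian.symm

/-- Green's formula: `∫ z Δw = ∫ (Δz) w` for `w ∈ W₀^{2,2}(Ω)`. -/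
theorem MemW0.inner_weakLaplacian (hΩ : IsOpen Ω) {w z g : L2 Ω} (hw : MemW0 Ω 2 w)
    (hz : IsWeakLaplacian Ω z g) : ⟪z, weakLaplacian Ω w⟫ = ⟪g, w⟫ := by
  obtain ⟨φ, hφ, h0, h2⟩ := hw.exists_seq hΩ
  rw [isWeakLaplacian_iff] at hz
  refine tendsto_nhds_unique (tendsto_const_nhds.inner h2) ?_
  simp only [hz _ (hφ _)]
  exact tendsto_const_nhds.inner h0

/-- Test w against Δ²φ = ∑ ∂ᵢᵢⱼⱼφ. Thus W^{4,2} regularity gives Δ²w meaning as an iterated weak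
Laplacian. -/
theorem isWeakLaplacian_weakLaplacian {w : L2 Ω} {D : Fin N → Fin N → L2 Ω}
    (hw : IsWeakLaplacian Ω w (weakLaplacian Ω w))
    (h : ∀ i j, IsWeakDeriv Ω ![i, i, j, j] w (D i j)) :
    IsWeakLaplacian Ω (weakLaplacian Ω w) (∑ i, ∑ j, D i j) := by
  rw [isWeakLaplacian_iff] at hw ⊢
  intro φ hφ
  rw [← hw _ hφ.laplacian, hφ.toL2_laplacian_laplacian]
  simp only [inner_sum, sum_inner]
  refine Finset.sum_congr rfl fun i _ => Finset.sum_congr rfl fun j _ => ?_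
  rw [(h i j).inner_eq hφ]; norm_num

/-- The Sobolev inequality `‖w‖_ρ ≤ S ‖Δw‖₂` in `W₀^{2,2}(Ω)`, with some constant. -/
theorem exists_sobolev (hN : 2 ≤ N) (hΩ : IsOpen Ω) (hΩb : Bornology.IsBounded Ω) {ρ : ℝ}
    (hρ : 2 < ρ) (hρN : 4 < N → ρ < 2 * (N : ℝ) / ((N : ℝ) - 4)) :
    ∃ S : ℝ, 0 ≤ S ∧ ∀ w : L2 Ω, MemW0 Ω 2 w →
      eLpNorm w (ENNReal.ofReal ρ) (volume.restrict Ω) ≤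
        ENNReal.ofReal (S * ‖weakLaplacian Ω w‖) := by
  obtain ⟨C, hC⟩ := exists_eLpNorm_le_laplacian (Ω := Ω) hN hΩb hρ hρN
  refine ⟨C, C.coe_nonneg, fun w hw => ?_⟩
  obtain ⟨φ, hφ, h0, h2⟩ := hw.exists_seq hΩ
  obtain ⟨ns, hns, hae⟩ := (tendstoInMeasure_of_tendsto_Lp h0).exists_seq_tendsto_ae
  have hbound : ∀ n, eLpNorm (hφ n).toL2 (ENNReal.ofReal ρ) (volume.restrict Ω) ≤
      ENNReal.ofReal (C * ‖(hφ n).laplacian.toL2‖) := by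
    intro n
    rw [eLpNorm_congr_ae (hφ n).coeFn_toL2, (hφ n).eLpNorm_restrict,
      ENNReal.ofReal_mul C.coe_nonneg, ofReal_norm, Lp.enorm_def, eLpNorm_congr_ae
      (hφ n).laplacian.coeFn_toL2, (hφ n).laplacian.eLpNorm_restrict]
    simpa using hC _ (hφ n)
  -- Fatou's lemma along an almost everywhere convergent subsequence; convergence in L^ρ is not
  -- needed.
  refine (Lp.eLpNorm_lim_le_liminf_eLpNorm (fun n => Lp.aestronglyMeasurable _) _ hae).trans ?_
  refine (liminf_le_liminf (Eventually.of_forall fun n => hbound (ns n))).trans (le_of_eq ?_)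
  refine Tendsto.liminf_eq (ENNReal.tendsto_ofReal ?_)
  exact ((h2.comp hns.tendsto_atTop).norm).const_mul _

theorem sobolevConst_nonneg (Ω : Set (EuclideanSpace ℝ (Fin N))) (ρ : ℝ) :
    0 ≤ sobolevConst Ω ρ :=
  Real.sInf_nonneg fun _ h => h.1

/-- The best constant is attained in the Sobolev inequality. -/
theorem sobolev_le (hN : 2 ≤ N) (hΩ : IsOpen Ω) (hΩb : Bornology.IsBounded Ω) {ρ : ℝ}
    (hρ : 2 < ρ) (hρN : 4 < N → ρ < 2 * (N : ℝ) / ((N : ℝ) - 4)) {w : L2 Ω} (hw : MemW0 Ω 2 w) :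
    eLpNorm w (ENNReal.ofReal ρ) (volume.restrict Ω) ≤
      ENNReal.ofReal (sobolevConst Ω ρ * ‖weakLaplacian Ω w‖) := by
  -- For fixed w the inequality is a closed condition on S, so it passes to the infimum.
  have hmem := csInf_mem_closure (exists_sobolev hN hΩ hΩb hρ hρN) ⟨0, fun _ h => h.1⟩
  have hclosed : IsClosed {S : ℝ | eLpNorm w (ENNReal.ofReal ρ) (volume.restrict Ω) ≤
      ENNReal.ofReal (S * ‖weakLaplacian Ω w‖)} :=
    isClosed_le continuous_const (ENNReal.continuous_ofReal.comp (by fun_prop))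
  exact closure_minimal (fun S hS => hS.2 w hw) hclosed hmem

/-- A zero constant would force w = 0, hence Δw = 0. Positivity keeps the denominator in the
definition of T away from zero. -/
theorem sobolevConst_pos (hN : 2 ≤ N) (hΩ : IsOpen Ω) (hΩb : Bornology.IsBounded Ω) {ρ : ℝ}
    (hρ : 2 < ρ) (hρN : 4 < N → ρ < 2 * (N : ℝ) / ((N : ℝ) - 4)) {w : L2 Ω} (hw : MemW0 Ω 2 w)
    (hne : weakLaplacian Ω w ≠ 0) : 0 < sobolevConst Ω ρ := by
  refine (sobolevConst_nonneg Ω ρ).lt_of_ne' fun h0 => hne ?_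
  have h := sobolev_le hN hΩ hΩb hρ hρN hw
  rw [h0, zero_mul, ENNReal.ofReal_zero, nonpos_iff_eq_zero, eLpNorm_eq_zero_iff
    (Lp.aestronglyMeasurable w) (by simpa using by linarith)] at h
  have hw0 : w = 0 := Lp.ext (h.trans (Lp.coeFn_zero _ _ _).symm)
  refine IsWeakLaplacian.eq_weakLaplacian hΩ (isWeakLaplacian_iff.2 fun φ hφ => ?_)
  rw [hw0, inner_zero_left, inner_zero_left]

/-- Since 0 ≤ f(z) ≤ z^r, the L² norm of f(z) is at most the r-th power of the L^{2r} norm of z, to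
which the Sobolev inequality applies. -/
theorem norm_source_sq_le (hN : 2 ≤ N) (hΩ : IsOpen Ω) (hΩb : Bornology.IsBounded Ω) {r : ℝ}
    (hr : 1 < r) (hrN : 4 < N → 2 * r < 2 * (N : ℝ) / ((N : ℝ) - 4)) {f : ℝ → ℝ}
    (hf : ∀ s : ℝ, 0 ≤ s → 0 ≤ f s ∧ f s ≤ s ^ r) {z F : L2 Ω} (hz : MemW0 Ω 2 z)
    (hz0 : ∀ᵐ x ∂(volume.restrict Ω), 0 ≤ z x)
    (hF : ∀ᵐ x ∂(volume.restrict Ω), F x = f (z x)) :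
    ‖F‖ ^ 2 ≤ sobolevConst Ω (2 * r) ^ (2 * r) * (‖weakLaplacian Ω z‖ ^ 2) ^ r := by
  have hr0 : 0 < r := by linarith
  have hS := sobolevConst_nonneg Ω (2 * r)
  have hsob := sobolev_le hN hΩ hΩb (by linarith) hrN hz
  have h1 : ‖F‖ₑ ≤ ENNReal.ofReal ((sobolevConst Ω (2 * r) * ‖weakLaplacian Ω z‖) ^ r) := by
    rw [Lp.enorm_def, ← ENNReal.ofReal_rpow_of_nonneg (by positivity) hr0.le]
    calc eLpNorm F 2 (volume.restrict Ω)
        ≤ eLpNorm (fun x => ‖z x‖ ^ r) 2 (volume.restrict Ω) := by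
          refine eLpNorm_mono_ae ?_
          filter_upwards [hz0, hF] with x h0 hx
          rw [hx, Real.norm_of_nonneg (hf _ h0).1, Real.norm_of_nonneg (by positivity),
            Real.norm_of_nonneg h0]
          exact (hf _ h0).2
      _ = eLpNorm z (ENNReal.ofReal (2 * r)) (volume.restrict Ω) ^ r := by
          rw [eLpNorm_norm_rpow _ hr0, ENNReal.ofReal_mul (by norm_num)]
          simp
      _ ≤ _ := by gcongr
  rw [← ofReal_norm, ENNReal.ofReal_le_ofReal_iff (by positivity)] at h1
  calc ‖F‖ ^ 2 ≤ ((sobolevConst Ω (2 * r) * ‖weakLaplacian Ω z‖) ^ r) ^ 2 := by gcongr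
    _ = _ := by
      rw [Real.mul_rpow hS (norm_nonneg _), mul_pow, ← Real.rpow_mul_natCast hS,
        ← Real.rpow_mul_natCast (norm_nonneg _), ← Real.rpow_natCast_mul (norm_nonneg _)]
      push_cast
      rw [mul_comm r 2]

end WeakLaplacian

/-! ### The chain rule for ‖Δu(t)‖² -/

section ChainRule

section Hilbert

theorem memLp_comp_const_add {E : Type*} [NormedAddCommGroup E] {f : ℝ → E}
    (hf : MemLp f 2 volume) (c : ℝ) :
    MemLp (fun x => f (c + x)) 2 volume :=
  hf.comp_measurePreserving (measurePreserving_add_left volume c)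

variable {H : Type*} [NormedAddCommGroup H] [InnerProductSpace ℝ H]

theorem integrable_inner_of_memLp_two {X : Type*} [MeasurableSpace X] {μ : Measure X}
    {f g : X → H} (hf : MemLp f 2 μ) (hg : MemLp g 2 μ) :
    Integrable (fun x => ⟪f x, g x⟫) μ := by
  refine (L2.integrable_inner (𝕜 := ℝ) (hf.toLp f) (hg.toLp g)).congr ?_
  filter_upwards [hf.coeFn_toLp, hg.coeFn_toLp] with x h1 h2
  rw [h1, h2]

/-- Integrals of products of translates of `L²` functions depend continuously on the shifts. -/
theorem continuous_integral_inner_translate {G W : ℝ → H} (hG : MemLp G 2 volume)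
    (hW : MemLp W 2 volume) (A : Set ℝ) :
    Continuous fun c : ℝ × ℝ => ∫ x in A, ⟪G x + G (c.1 + x), W (c.2 + x)⟫ := by
  have : Fact ((2 : ℝ≥0∞) ≠ ⊤) := ⟨by norm_num⟩
  have hT : ∀ {f : ℝ → H} (hf : MemLp f 2 volume),
      Continuous fun c : ℝ => DomAddAct.mk c +ᵥ hf.toLp f := fun hf =>
    DomAddAct.continuous_mk.vadd continuous_const
  let R := LpToLpRestrictCLM ℝ H ℝ (volume : Measure ℝ) 2 A
  -- Translations act continuously on L², and restriction and the inner product are continuous.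
  have hcont : Continuous fun c : ℝ × ℝ =>
      ⟪R (hG.toLp G + (DomAddAct.mk c.1 +ᵥ hG.toLp G)), R (DomAddAct.mk c.2 +ᵥ hW.toLp W)⟫ :=
    (R.continuous.comp (continuous_const.add ((hT hG).comp continuous_fst))).inner
      (R.continuous.comp ((hT hW).comp continuous_snd))
  refine hcont.congr fun c => ?_
  rw [L2.inner_def]
  refine integral_congr_ae ?_
  have hr : ∀ {f g : ℝ → H}, f =ᵐ[volume] g → f =ᵐ[volume.restrict A] g := fun h =>
    ae_restrict_of_ae h
  rw [DomAddAct.mk_vadd_toLp, DomAddAct.mk_vadd_toLp]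
  filter_upwards [LpToLpRestrictCLM_coeFn ℝ A
      (hG.toLp G + (memLp_comp_const_add hG c.1).toLp fun x => G (c.1 + x)),
    LpToLpRestrictCLM_coeFn ℝ A ((memLp_comp_const_add hW c.2).toLp fun x => W (c.2 + x)),
    hr (Lp.coeFn_add (hG.toLp G) ((memLp_comp_const_add hG c.1).toLp fun x => G (c.1 + x))),
    hr hG.coeFn_toLp, hr (memLp_comp_const_add hG c.1).coeFn_toLp,
    hr (memLp_comp_const_add hW c.2).coeFn_toLp] with x h1 h2 h3 h4 h5 h6
  change ⟪(LpToLpRestrictCLM ℝ H ℝ volume 2 A (hG.toLp G +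
    (memLp_comp_const_add hG c.1).toLp fun x => G (c.1 + x))) x,
    (LpToLpRestrictCLM ℝ H ℝ volume 2 A
      ((memLp_comp_const_add hW c.2).toLp fun x => W (c.2 + x))) x⟫ = _
  rw [h1, h2, h3, Pi.add_apply, h4, h5, h6]

/-- Fubini. It turns a pairing with an increment u(x + h) - u(x) into an integral over shifts c in
(0, h). -/
theorem integral_inner_integral_swap [CompleteSpace H] {E W : ℝ → H} (hE : MemLp E 2 volume)
    (hW : MemLp W 2 volume) (s t : ℝ) {h : ℝ} (hh : 0 ≤ h) :
    ∫ x in Ioc s t, ⟪E x, ∫ c in (0 : ℝ)..h, W (c + x)⟫ =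
      ∫ c in (0 : ℝ)..h, ∫ x in Ioc s t, ⟪E x, W (c + x)⟫ := by
  have hloc : ∀ x, IntegrableOn (fun c => W (c + x)) (Ioc 0 h) volume := fun x => by
    have : MemLp (fun c => W (c + x)) 2 volume :=
      hW.comp_measurePreserving (measurePreserving_add_right volume x)
    exact ((this.locallyIntegrable (by norm_num)).integrableOn_isCompact isCompact_Icc).mono_set
      Ioc_subset_Icc_self
  simp only [intervalIntegral.integral_of_le hh]
  simp only [← fun x => integral_inner (𝕜 := ℝ) (hloc x) (E x)]
  refine integral_integral_swap (f := fun x c => ⟪E x, W (c + x)⟫) ?_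
  refine integrable_inner_of_memLp_two (H := H) (f := fun z : ℝ × ℝ => E z.1)
    (g := fun z : ℝ × ℝ => W (z.2 + z.1)) ((hE.restrict _).comp_fst _) ?_
  have h1 : MemLp (fun z : ℝ × ℝ => W (z.1 + z.2)) 2 (volume.prod (volume.restrict (Ioc 0 h))) :=
    (hW.comp_fst (volume.restrict (Ioc 0 h))).comp_measurePreserving
      (measurePreserving_add_prod volume (volume.restrict (Ioc 0 h)))
  have h2 := h1.mono_measure (Measure.prod_mono (Measure.restrict_le_self (s := Ioc s t)) le_rfl)
  simpa only [add_comm] using h2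

/-- The chain rule `(‖a‖²)' = 2 ⟪g, u'⟫` in a Gelfand triple: here `g` is the image of `u` under
the operator associated with the form `⟪a, a⟫`. -/
theorem norm_sq_sub_norm_sq_eq_integral [CompleteSpace H] {T : ℝ} {u a g w : ℝ → H}
    (hw : MemLp w 2 (volume.restrict (Ioo 0 T))) (hg : MemLp g 2 (volume.restrict (Ioo 0 T)))
    (hu : ∀ t ∈ Icc 0 T, u t = u 0 + ∫ s in (0 : ℝ)..t, w s) (ha : ContinuousOn a (Icc 0 T))
    (hsym : ∀ᵐ t ∂(volume.restrict (Ioo 0 T)), ∀ t' ∈ Icc 0 T, ⟪g t, u t'⟫ = ⟪a t, a t'⟫)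
    {s t : ℝ} (hs : 0 ≤ s) (hst : s ≤ t) (htT : t < T) :
    ‖a t‖ ^ 2 - ‖a s‖ ^ 2 = ∫ τ in Ioc s t, 2 * ⟪g τ, w τ⟫ := by
  have hT : (0 : ℝ) ≤ T := by linarith
  set W : ℝ → H := (Ioo 0 T).indicator w with hWdef
  set G : ℝ → H := (Ioo 0 T).indicator g with hGdef
  have hW : MemLp W 2 volume := (memLp_indicator_iff_restrict measurableSet_Ioo).2 hw
  have hG : MemLp G 2 volume := (memLp_indicator_iff_restrict measurableSet_Ioo).2 hg
  have hWi : ∀ x y : ℝ, IntervalIntegrable W volume x y := fun x y =>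
    ((hW.locallyIntegrable (by norm_num)).integrableOn_isCompact isCompact_uIcc).intervalIntegrable
  have hu' : ∀ x ∈ Ico 0 T, u x = u 0 + ∫ c in (0 : ℝ)..x, W c := by
    intro x hx
    rw [hu x (Ico_subset_Icc_self hx)]
    congr 1
    rw [intervalIntegral.integral_of_le hx.1, intervalIntegral.integral_of_le hx.1]
    refine setIntegral_congr_fun measurableSet_Ioc fun c hc => ?_
    rw [hWdef, indicator_of_mem (show c ∈ Ioo 0 T from ⟨hc.1, hc.2.trans_lt hx.2⟩)]
  have hdiff : ∀ x h : ℝ, 0 ≤ x → 0 ≤ h → x + h < T →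
      u (x + h) - u x = ∫ c in (0 : ℝ)..h, W (c + x) := by
    intro x h hx hh hxh
    rw [hu' _ ⟨by linarith, hxh⟩, hu' x ⟨hx, by linarith⟩, add_sub_add_left_eq_sub,
      intervalIntegral.integral_interval_sub_left (hWi _ _) (hWi _ _),
      intervalIntegral.integral_comp_add_right, zero_add, add_comm]
  have hsym' : ∀ᵐ x : ℝ, x ∈ Ioo 0 T → ∀ t' ∈ Icc 0 T, ⟪G x, u t'⟫ = ⟪a x, a t'⟫ := by
    have := (ae_restrict_iff' (μ := volume) (measurableSet_Ioo (a := (0 : ℝ)) (b := T))).1 hsym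
    filter_upwards [this] with x hx hxT t' ht'
    rw [hGdef, indicator_of_mem hxT, hx hxT t' ht']
  set F : ℝ → ℝ := IccExtend hT fun x : Icc 0 T => ‖a x‖ ^ 2 with hFdef
  have hFc : Continuous F := (continuousOn_iff_continuous_domRestrict.1 (ha.norm.pow 2)).Icc_extend'
  have hF : ∀ x ∈ Icc 0 T, F x = ‖a x‖ ^ 2 := fun x hx => by
    rw [hFdef, IccExtend_of_mem _ _ hx]
  have hFi : ∀ x y : ℝ, IntervalIntegrable F volume x y := fun x y => hFc.intervalIntegrable x y
  set K : ℝ × ℝ → ℝ := fun c => ∫ x in Ioc s t, ⟪G x + G (c.1 + x), W (c.2 + x)⟫ with hKdef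
  have hK : Continuous K := continuous_integral_inner_translate hG hW _
  set Q : ℝ → ℝ := fun x => ∫ c in (0 : ℝ)..x, F c with hQdef
  have hQ : ∀ x, HasDerivAt Q (F x) x := fun x => (hFc.integral_hasStrictDerivAt 0 x).hasDerivAt
  -- By symmetry the cross terms cancel in ⟪g(x) + g(x+h), u(x+h) - u(x)⟫ = ‖a(x+h)‖² - ‖a(x)‖².
  -- Integrating over x leaves only the two end pieces of Q. Divided by h, the left side tends to
  -- ‖a(t)‖² - ‖a(s)‖² and the right side to K(0, 0).
  have hquot : ∀ h ∈ Ioo 0 (T - t), (Q (t + h) - Q t) - (Q (s + h) - Q s) =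
      ∫ c in (0 : ℝ)..h, K (h, c) := by
    intro h hh
    have e1 : (Q (t + h) - Q t) - (Q (s + h) - Q s) = ∫ x in Ioc s t, (F (x + h) - F x) := by
      have hFh : IntervalIntegrable (fun x => F (x + h)) volume s t :=
        (hFc.comp (continuous_add_const h)).intervalIntegrable _ _
      rw [← intervalIntegral.integral_of_le hst, intervalIntegral.integral_sub hFh (hFi _ _),
        intervalIntegral.integral_comp_add_right F h,
        ← intervalIntegral.integral_interval_sub_left (hFi 0 (t + h)) (hFi 0 (s + h)),
        ← intervalIntegral.integral_interval_sub_left (hFi 0 t) (hFi 0 s)]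
      ring
    rw [e1]
    refine Eq.trans (integral_congr_ae ?_)
      (integral_inner_integral_swap (hG.add (memLp_comp_const_add hG h)) hW s t hh.1.le)
    rw [EventuallyEq, ae_restrict_iff' measurableSet_Ioc]
    -- The symmetry is needed at x and at h + x; a translate of the exceptional null set is again
    -- null.
    filter_upwards [hsym',
      (measurePreserving_add_left volume h).quasiMeasurePreserving.ae hsym'] with x hx hxh hxm
    have hx0 : 0 < x := hs.trans_lt hxm.1
    have hxT : x + h < T := by linarith [hxm.2, hh.2]
    have hxI : x ∈ Ioo 0 T := ⟨hx0, by linarith [hh.1]⟩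
    have hxhI : h + x ∈ Ioo 0 T := ⟨by linarith [hh.1], by linarith⟩
    have i1 := Ioo_subset_Icc_self hxI
    have i2 := Ioo_subset_Icc_self hxhI
    rw [← hdiff x h hx0.le hh.1.le hxT, add_comm x h, hF _ i1, hF _ i2, Pi.add_apply,
      inner_sub_right, inner_add_left, inner_add_left, hx hxI _ i1, hx hxI _ i2, hxh hxhI _ i1,
      hxh hxhI _ i2, real_inner_self_eq_norm_sq, real_inner_self_eq_norm_sq,
      real_inner_comm (a x) (a (h + x))]
    ring
  have hlim1 : Tendsto (fun h : ℝ => h⁻¹ • (∫ c in (0 : ℝ)..h, K (h, c))) (𝓝[>] 0)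
      (𝓝 (‖a t‖ ^ 2 - ‖a s‖ ^ 2)) := by
    have := (hQ t).tendsto_slope_zero_right.sub (hQ s).tendsto_slope_zero_right
    rw [hF t ⟨by linarith, htT.le⟩, hF s ⟨hs, by linarith⟩] at this
    refine this.congr' ?_
    filter_upwards [Ioo_mem_nhdsGT (show (0 : ℝ) < T - t by linarith)] with h hh
    rw [← smul_sub, hquot h hh]
  have hlim2 : Tendsto (fun h : ℝ => h⁻¹ • (∫ c in (0 : ℝ)..h, K (h, c))) (𝓝[>] 0)
      (𝓝 (K (0, 0))) := by
    rw [Metric.tendsto_nhds]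
    intro ε hε
    obtain ⟨δ, hδ, hKδ⟩ := Metric.continuousAt_iff.1 hK.continuousAt (ε / 2) (half_pos hε)
    filter_upwards [Ioo_mem_nhdsGT hδ] with h hh
    have hbd : ‖∫ c in (0 : ℝ)..h, (K (h, c) - K (0, 0))‖ ≤ ε / 2 * |h - 0| := by
      refine intervalIntegral.norm_integral_le_of_norm_le_const fun c hc => ?_
      rw [uIoc_of_le hh.1.le] at hc
      refine (hKδ (x := (h, c)) ?_).le
      rw [Prod.dist_eq, max_lt_iff]
      simp only [Real.dist_eq, sub_zero]
      rw [abs_of_pos hh.1, abs_of_pos hc.1]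
      exact ⟨hh.2, hc.2.trans_lt hh.2⟩
    have hKi : IntervalIntegrable (fun c => K (h, c)) volume 0 h :=
      (hK.comp (by fun_prop : Continuous fun c : ℝ => (h, c))).intervalIntegrable _ _
    rw [intervalIntegral.integral_sub hKi intervalIntegrable_const,
      intervalIntegral.integral_const, sub_zero, abs_of_pos hh.1] at hbd
    have e : h⁻¹ • (∫ c in (0 : ℝ)..h, K (h, c)) - K (0, 0) =
        h⁻¹ • ((∫ c in (0 : ℝ)..h, K (h, c)) - h • K (0, 0)) := by
      rw [smul_sub, smul_smul, inv_mul_cancel₀ hh.1.ne', one_smul]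
    rw [dist_eq_norm, e, norm_smul, norm_inv, Real.norm_of_nonneg hh.1.le,
      inv_mul_lt_iff₀ hh.1]
    nlinarith [hh.1]
  rw [tendsto_nhds_unique hlim1 hlim2]
  refine setIntegral_congr_fun measurableSet_Ioc fun x hx => ?_
  have hxI : x ∈ Ioo 0 T := ⟨hs.trans_lt hx.1, hx.2.trans_lt htT⟩
  simp only [zero_add, hWdef, hGdef, indicator_of_mem hxI, ← two_smul ℝ (g x),
    real_inner_smul_left]

end Hilbert

end ChainRule

/-! ### Comparison with the Bernoulli equation -/

section Comparison

section ODE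

/-- Strict superadditivity: write x^p = x · x^{p-1}; for positive a, b both a^{p-1} and b^{p-1} lie
strictly below (a + b)^{p-1}. -/
theorem eq_zero_or_eq_zero_of_rpow_add_rpow {a b p : ℝ} (hp : 1 < p) (ha : 0 ≤ a) (hb : 0 ≤ b)
    (h : (a + b) ^ p ≤ a ^ p + b ^ p) : a = 0 ∨ b = 0 := by
  by_contra! hab
  have ha' : 0 < a := ha.lt_of_ne' hab.1
  have hb' : 0 < b := hb.lt_of_ne' hab.2
  have e : ∀ x : ℝ, 0 < x → x ^ p = x * x ^ (p - 1) := fun x hx => by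
    rw [Real.rpow_sub_one hx.ne', mul_div_cancel₀ _ hx.ne']
  have h1 : a ^ (p - 1) < (a + b) ^ (p - 1) :=
    Real.rpow_lt_rpow ha (by linarith) (by linarith)
  have h2 : b ^ (p - 1) < (a + b) ^ (p - 1) :=
    Real.rpow_lt_rpow hb (by linarith) (by linarith)
  rw [e a ha', e b hb', e (a + b) (by linarith)] at h
  nlinarith [mul_lt_mul_of_pos_left h1 ha', mul_lt_mul_of_pos_left h2 hb']

variable {p q B K c a b R : ℝ}

/-- For q < p each source term is bounded by K R^p separately, which costs the factor 2; for q = p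
superadditivity of the power saves it. -/
theorem growth_le (hq : 1 < q) (hqp : q ≤ p) (hB : 0 < B) (hK : 0 < K) (hc : 0 < c)
    (ha : 0 ≤ a) (hb : 0 ≤ b) (hR : a + b ≤ R) (hcR : c ≤ R) :
    B * a + K * b ^ p + (B * b + K * c ^ (p - q) * a ^ q) ≤
      B * R + (if q < p then 2 * K else K) * R ^ p := by
  have hR0 : 0 < R := hc.trans_le hcR
  have hp0 : 0 ≤ p := by linarith
  have hBR : B * (a + b) ≤ B * R := by gcongr
  split_ifs with hlt
  · have h1 : b ^ p ≤ R ^ p := by gcongr; linarith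
    have h2 : c ^ (p - q) * a ^ q ≤ R ^ (p - q) * R ^ q := by
      gcongr <;> linarith
    rw [← Real.rpow_add hR0, sub_add_cancel] at h2
    nlinarith
  · obtain rfl : q = p := le_antisymm hqp (not_lt.1 hlt)
    have h1 := Real.add_rpow_le_rpow_add ha hb hq.le
    have h2 : (a + b) ^ q ≤ R ^ q := by gcongr
    rw [sub_self, Real.rpow_zero]
    nlinarith

/-- Equality in the sum makes every single estimate an equality. For q < p this is impossible: b = R
gives a = 0, so the other source term vanishes instead of reaching R^p. -/
theorem eq_of_growth_eq (hq : 1 < q) (hqp : q ≤ p) (hB : 0 < B) (hK : 0 < K) (hc : 0 < c)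
    (ha : 0 ≤ a) (hb : 0 ≤ b) (hR : a + b ≤ R) (hcR : c ≤ R)
    (h : B * a + K * b ^ p + (B * b + K * c ^ (p - q) * a ^ q) =
      B * R + (if q < p then 2 * K else K) * R ^ p) :
    R = a + b ∧ (a = 0 ∨ b = 0) := by
  have hR0 : 0 < R := hc.trans_le hcR
  have hp0 : 0 < p := by linarith
  have hBR : B * (a + b) ≤ B * R := by gcongr
  split_ifs at h with hlt
  · exfalso
    have h1 : b ^ p ≤ R ^ p := by gcongr; linarith
    have h2 : c ^ (p - q) * a ^ q ≤ R ^ (p - q) * R ^ q := by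
      gcongr <;> linarith
    rw [← Real.rpow_add hR0, sub_add_cancel] at h2
    have h3 : b ^ p = R ^ p := by nlinarith
    have h4 : c ^ (p - q) * a ^ q = R ^ p := by nlinarith
    have h5 : b = R := (Real.rpow_left_inj hb hR0.le hp0.ne').1 h3
    have h6 : a = 0 := by linarith
    rw [h6, Real.zero_rpow (by linarith), mul_zero] at h4
    exact (Real.rpow_pos_of_pos hR0 p).ne h4
  · obtain rfl : q = p := le_antisymm hqp (not_lt.1 hlt)
    have h1 := Real.add_rpow_le_rpow_add ha hb hq.le
    have h2 : (a + b) ^ q ≤ R ^ q := by gcongr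
    rw [sub_self, Real.rpow_zero] at h
    have h3 : B * (a + b) = B * R := by nlinarith
    have h4 : (a + b) ^ q ≤ a ^ q + b ^ q := by nlinarith
    exact ⟨(mul_left_cancel₀ hB.ne' h3).symm, eq_zero_or_eq_zero_of_rpow_add_rpow hq ha hb h4⟩

end ODE

/-- Comparison with the Bernoulli equation `R' = B R + C R ^ p`: `R` stays bounded up to the blow-up
time of the equation, provided that it is not itself a solution. -/
theorem bounded_of_bernoulli {p B C τ : ℝ} (hp : 1 < p) (hB : 0 < B) (hC : 0 < C) (hτ : 0 < τ)
    {R G : ℝ → ℝ} (hR : ∀ t ∈ Iio τ, HasDerivAt R (G t) t) (hR0 : 0 < R 0)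
    (hRm : MonotoneOn R (Ico 0 τ)) (hG : ∀ t ∈ Ico 0 τ, G t ≤ B * R t + C * R t ^ p)
    (hne : ∃ t ∈ Ioo 0 τ, G t ≠ B * R t + C * R t ^ p)
    (hT : τ ≤ 1 / (B * (p - 1)) * Real.log (1 + B / C * R 0 ^ (1 - p))) :
    ∃ M, ∀ t ∈ Ico 0 τ, R t ≤ M := by
  have hp1 : 0 < p - 1 := by linarith
  have h0m : (0 : ℝ) ∈ Ico 0 τ := ⟨le_rfl, hτ⟩
  have hRpos : ∀ t ∈ Ico 0 τ, 0 < R t := fun t ht => hR0.trans_le (hRm h0m ht ht.1)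
  -- The substitution R^{1-p} linearises the equation, and the exponential is the integrating
  -- factor: Z is constant on exact solutions and nondecreasing under the inequality.
  set Z : ℝ → ℝ := fun t => (R t ^ (1 - p) + C / B) * Real.exp ((p - 1) * B * t) with hZ
  set D : ℝ → ℝ := fun t => (p - 1) * Real.exp ((p - 1) * B * t) * R t ^ (-p) *
    (B * R t + C * R t ^ p - G t) with hD
  have hZD : ∀ t ∈ Ico 0 τ, HasDerivAt Z (D t) t := by
    intro t ht
    have hpos := hRpos t ht
    have h1 := ((hR t ht.2).rpow_const (p := 1 - p) (Or.inl hpos.ne')).add_const (C / B)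
    have h2 : HasDerivAt (fun t => Real.exp ((p - 1) * B * t))
        (Real.exp ((p - 1) * B * t) * ((p - 1) * B)) t := by
      simpa using ((hasDerivAt_id t).const_mul ((p - 1) * B)).exp
    refine (h1.mul h2).congr_deriv ?_
    have e1 : R t ^ (1 - p) = R t * R t ^ (-p) := by
      rw [sub_eq_add_neg, Real.rpow_add hpos, Real.rpow_one]
    have e2 : R t ^ p * R t ^ (-p) = 1 := by
      rw [← Real.rpow_add hpos, add_neg_cancel, Real.rpow_zero]
    have e3 : R t ^ (1 - p - 1) = R t ^ (-p) := by congr 1; ring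
    simp only [hD]
    rw [e3, e1]
    have e4 : C / B * B = C := div_mul_cancel₀ _ hB.ne'
    linear_combination (p - 1) * Real.exp ((p - 1) * B * t) * (e4 - C * e2)
  have hDnn : ∀ t ∈ Ico 0 τ, 0 ≤ D t := fun t ht => by
    have := hG t ht
    have := hRpos t ht
    exact mul_nonneg (by positivity) (by linarith)
  have hZm : MonotoneOn Z (Ico 0 τ) := by
    refine monotoneOn_of_hasDerivWithinAt_nonneg (convex_Ico 0 τ)
      (fun t ht => (hZD t ht).continuousAt.continuousWithinAt) (f' := D) ?_ ?_
    · intro t ht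
      exact (hZD t (interior_subset ht)).hasDerivWithinAt
    · intro t ht
      exact hDnn t (interior_subset ht)
  obtain ⟨t₁, ht₁, hlt⟩ : ∃ t₁ ∈ Ico 0 τ, Z 0 < Z t₁ := by
    by_contra! hcon
    obtain ⟨t, ht, htne⟩ := hne
    refine htne ?_
    have hconst : Z =ᶠ[𝓝 t] fun _ => Z 0 := by
      filter_upwards [isOpen_Ioo.mem_nhds ht] with x hx
      have hx' := Ioo_subset_Ico_self hx
      exact le_antisymm (hcon x hx') (hZm h0m hx' hx'.1)
    have hD0 : D t = 0 :=
      (hZD t (Ioo_subset_Ico_self ht)).unique ((hasDerivAt_const t (Z 0)).congr_of_eventuallyEq hconst)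
    have hpos := hRpos t (Ioo_subset_Ico_self ht)
    have hfac : (p - 1) * Real.exp ((p - 1) * B * t) * R t ^ (-p) ≠ 0 := by positivity
    have := (mul_eq_zero.1 hD0).resolve_left hfac
    linarith
  have hCB : 0 < C / B := by positivity
  have hZ0 : Z 0 = R 0 ^ (1 - p) + C / B := by simp [hZ]
  have hZ0pos : 0 < Z 0 := by rw [hZ0]; positivity
  have hexp : Real.exp ((p - 1) * B * τ) ≤ Z 0 / (C / B) := by
    have harg : 0 < 1 + B / C * R 0 ^ (1 - p) := by positivity
    have e : Z 0 / (C / B) = 1 + B / C * R 0 ^ (1 - p) := by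
      rw [hZ0]; field_simp; ring
    rw [e, ← Real.le_log_iff_exp_le harg]
    calc (p - 1) * B * τ ≤ (p - 1) * B *
          (1 / (B * (p - 1)) * Real.log (1 + B / C * R 0 ^ (1 - p))) := by gcongr
      _ = _ := by field_simp
  -- From t₁ on, Z ≥ Z(t₁) > Z(0), whereas the exponential is at most Z(0)/(C/B) up to τ. Dividing
  -- leaves R^{1-p} ≥ d > 0, an upper bound for R.
  set d : ℝ := C / B * (Z t₁ / Z 0 - 1) with hd
  have hdpos : 0 < d := by
    have : 1 < Z t₁ / Z 0 := (one_lt_div hZ0pos).2 hlt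
    exact mul_pos hCB (by linarith)
  refine ⟨(d⁻¹) ^ (p - 1)⁻¹, fun t ht => ?_⟩
  have hm : max t t₁ ∈ Ico 0 τ := ⟨ht.1.trans (le_max_left _ _), max_lt ht.2 ht₁.2⟩
  refine (hRm ht hm (le_max_left _ _)).trans ?_
  set x := max t t₁
  have hxpos := hRpos x hm
  have h1 : Z t₁ ≤ Z x := hZm ht₁ hm (le_max_right _ _)
  have h2 : Z x ≤ (R x ^ (1 - p) + C / B) * (Z 0 / (C / B)) := by
    simp only [hZ]
    gcongr
    refine le_trans (Real.exp_le_exp.2 ?_) hexp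
    have := hm.2.le
    gcongr
  have h3 : d ≤ R x ^ (1 - p) := by
    have h4 : Z t₁ / Z 0 * (C / B) ≤ R x ^ (1 - p) + C / B := by
      have := h1.trans h2
      rw [← mul_div_assoc, le_div_iff₀ hCB] at this
      rw [div_mul_eq_mul_div, div_le_iff₀ hZ0pos]
      exact this
    rw [hd]
    linarith
  have h5 : R x ^ (p - 1) ≤ d⁻¹ := by
    rw [le_inv_comm₀ (by positivity) hdpos, ← Real.rpow_neg hxpos.le, neg_sub]
    exact h3
  calc R x = (R x ^ (p - 1)) ^ (p - 1)⁻¹ := by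
        rw [Real.rpow_rpow_inv hxpos.le hp1.ne']
    _ ≤ _ := by gcongr

/-- A system of integral inequalities coupled through powers stays bounded up to the blow-up time
of the corresponding Bernoulli equation. -/
theorem bounded_of_integral_inequalities_aux {p q B K τ c : ℝ} (hq : 1 < q) (hqp : q ≤ p)
    (hB : 0 < B) (hK : 0 < K) (hτ : 0 < τ) {a b : ℝ → ℝ} (ha : ContinuousOn a (Iio τ))
    (hb : ContinuousOn b (Iio τ)) (ha0 : ∀ t, 0 ≤ a t) (hb0 : ∀ t, 0 ≤ b t)
    (hc : c = a 0 + b 0) (hcpos : 0 < c)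
    (hia : ∀ s t, 0 ≤ s → s ≤ t → t < τ → a t - a s ≤ ∫ x in s..t, (B * a x + K * b x ^ p))
    (hib : ∀ s t, 0 ≤ s → s ≤ t → t < τ →
      b t - b s ≤ ∫ x in s..t, (B * b x + K * c ^ (p - q) * a x ^ q))
    (hT : τ ≤ 1 / (B * (p - 1)) *
      Real.log (1 + B / (if q < p then 2 * K else K) * c ^ (1 - p))) :
    ∃ M, ∀ t ∈ Ico 0 τ, a t + b t ≤ M := by
  set C := if q < p then 2 * K else K with hCdef
  have hCpos : 0 < C := by rw [hCdef]; split_ifs <;> positivity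
  have hga : ContinuousOn (fun x => B * a x + K * b x ^ p) (Iio τ) :=
    (ha.const_mul B).add ((hb.rpow_const fun x _ => Or.inr (by linarith)).const_mul K)
  have hgb : ContinuousOn (fun x => B * b x + K * c ^ (p - q) * a x ^ q) (Iio τ) :=
    (hb.const_mul B).add ((ha.rpow_const fun x _ => Or.inr (by linarith)).const_mul _)
  have hint : ∀ {g : ℝ → ℝ}, ContinuousOn g (Iio τ) → ∀ {s t}, s < τ → t < τ →
      IntervalIntegrable g volume s t := fun hg s t hs ht =>
    (hg.mono fun x hx => hx.2.trans_lt (max_lt hs ht)).intervalIntegrable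
  set G : ℝ → ℝ := fun x => B * a x + K * b x ^ p + (B * b x + K * c ^ (p - q) * a x ^ q) with hG
  have hGc : ContinuousOn G (Iio τ) := hga.add hgb
  have hG0 : ∀ x, 0 ≤ G x := fun x => by
    have := ha0 x
    have := hb0 x
    positivity
  set R : ℝ → ℝ := fun t => c + ∫ x in (0 : ℝ)..t, G x with hR
  have hRd : ∀ t ∈ Iio τ, HasDerivAt R (G t) t := fun t ht =>
    (intervalIntegral.integral_hasDerivAt_right (hint hGc hτ ht)
      (hGc.stronglyMeasurableAtFilter isOpen_Iio t ht)
      (hGc.continuousAt (isOpen_Iio.mem_nhds ht))).const_add c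
  have hRsub : ∀ s t, s < τ → t < τ → R t - R s = ∫ x in s..t, G x := fun s t hs ht => by
    simp only [hR]
    rw [add_sub_add_left_eq_sub,
      intervalIntegral.integral_interval_sub_left (hint hGc hτ ht) (hint hGc hτ hs)]
  have hR0 : R 0 = c := by simp [hR]
  have hRm : MonotoneOn R (Ico 0 τ) := fun s hs t ht hst => by
    rw [← sub_nonneg, hRsub s t hs.2 ht.2]
    exact intervalIntegral.integral_nonneg hst fun x _ => hG0 x
  have hcR : ∀ t ∈ Ico 0 τ, c ≤ R t := fun t ht => by
    rw [← hR0]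
    exact hRm ⟨le_rfl, hτ⟩ ht ht.1
  have hle : ∀ t ∈ Ico 0 τ, a t + b t ≤ R t := fun t ht => by
    have h1 := hia 0 t le_rfl ht.1 ht.2
    have h2 := hib 0 t le_rfl ht.1 ht.2
    simp only [hR, hG]
    rw [intervalIntegral.integral_add (hint hga hτ ht.2) (hint hgb hτ ht.2)]
    linarith
  have hGR : ∀ t ∈ Ico 0 τ, G t ≤ B * R t + C * R t ^ p := fun t ht =>
    growth_le hq hqp hB hK hcpos (ha0 t) (hb0 t) (hle t ht) (hcR t ht)
  have hne : ∃ t ∈ Ioo 0 τ, G t ≠ B * R t + C * R t ^ p := by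
    by_contra! hcon
    have hex : ∀ t ∈ Ioo 0 τ, R t = a t + b t ∧ (a t = 0 ∨ b t = 0) := fun t ht =>
      eq_of_growth_eq hq hqp hB hK hcpos (ha0 t) (hb0 t) (hle t (Ioo_subset_Ico_self ht))
        (hcR t (Ioo_subset_Ico_self ht)) (hcon t ht)
    -- No f growing at most at the linear rate B can coincide with R, whose derivative exceeds BR by
    -- at least C c^p. The times τ/3 and τ/2 are arbitrary interior ones.
    have key : ∀ f : ℝ → ℝ, (∀ t ∈ Ioo 0 τ, R t = f t) →
        (∀ s t, 0 < s → s ≤ t → t < τ → f t - f s ≤ ∫ x in s..t, B * f x) → False := by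
      intro f hf hfi
      have hs : τ / 3 ∈ Ioo 0 τ := ⟨by linarith, by linarith⟩
      have ht : τ / 2 ∈ Ioo 0 τ := ⟨by linarith, by linarith⟩
      have hst : τ / 3 ≤ τ / 2 := by linarith
      have h1 := hfi _ _ hs.1 hst ht.2
      rw [← hf _ hs, ← hf _ ht, hRsub _ _ hs.2 ht.2] at h1
      have hRc : ContinuousOn R (Iio τ) := fun x hx => (hRd x hx).continuousAt.continuousWithinAt
      have hsub : uIcc (τ / 3) (τ / 2) ⊆ Ioo 0 τ := by
        rw [uIcc_of_le hst]
        exact fun x hx => ⟨hs.1.trans_le hx.1, hx.2.trans_lt ht.2⟩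
      have h2 : ∫ x in (τ / 3)..(τ / 2), B * f x = ∫ x in (τ / 3)..(τ / 2), B * R x :=
        intervalIntegral.integral_congr fun x hx => by simp only [hf x (hsub hx)]
      have h3 : ∫ x in (τ / 3)..(τ / 2), (B * R x + C * c ^ p) ≤ ∫ x in (τ / 3)..(τ / 2), G x := by
        refine intervalIntegral.integral_mono_on hst
          (hint ((hRc.const_mul B).add continuousOn_const) hs.2 ht.2) (hint hGc hs.2 ht.2)
          fun x hx => ?_
        have hx' : x ∈ Ioo 0 τ := hsub (by rwa [uIcc_of_le hst])
        rw [hcon x hx']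
        have := hcR x (Ioo_subset_Ico_self hx')
        have : c ^ p ≤ R x ^ p := by gcongr; linarith
        gcongr
      rw [intervalIntegral.integral_add (hint (hRc.const_mul B) hs.2 ht.2)
        intervalIntegrable_const, intervalIntegral.integral_const, smul_eq_mul] at h3
      have : 0 < (τ / 2 - τ / 3) * (C * c ^ p) := by
        have : 0 < τ / 2 - τ / 3 := by linarith
        positivity
      linarith
    -- If the roles switched, a - b would vanish somewhere; there a = b = 0, against R = a + b ≥ c >
    -- 0.
    have hsgn : (∀ t ∈ Ioo 0 τ, a t = 0) ∨ ∀ t ∈ Ioo 0 τ, b t = 0 := by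
      by_contra! hab
      obtain ⟨⟨s, hs, has⟩, t, ht, hbt⟩ := hab
      have hbs : b s = 0 := (hex s hs).2.resolve_left has
      have hat : a t = 0 := (hex t ht).2.resolve_right hbt
      have hcont : ContinuousOn (fun x => a x - b x) (Ioo 0 τ) :=
        (ha.sub hb).mono fun x hx => hx.2
      obtain ⟨x, hx, hx0⟩ := isPreconnected_Ioo.intermediate_value ht hs hcont
        (show (0 : ℝ) ∈ Icc (a t - b t) (a s - b s) by
          rw [hat, hbs]; exact ⟨by linarith [hb0 t], by linarith [ha0 s]⟩)
      have hRx := hcR x (Ioo_subset_Ico_self hx)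
      have := (hex x hx).1
      simp only at hx0
      rcases (hex x hx).2 with h | h <;> linarith
    have hmem : ∀ {s t x : ℝ}, 0 < s → s ≤ t → t < τ → x ∈ uIcc s t → x ∈ Ioo 0 τ :=
      fun hs hst ht hx => by
        rw [uIcc_of_le hst] at hx
        exact ⟨hs.trans_le hx.1, hx.2.trans_lt ht⟩
    rcases hsgn with h0 | h0
    · refine key b (fun t ht => by rw [(hex t ht).1, h0 t ht, zero_add]) fun s t hs hst ht => ?_
      refine (hib s t hs.le hst ht).trans_eq (intervalIntegral.integral_congr fun x hx => ?_)
      simp only [h0 x (hmem hs hst ht hx), Real.zero_rpow (show q ≠ 0 by linarith), mul_zero,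
        add_zero]
    · refine key a (fun t ht => by rw [(hex t ht).1, h0 t ht, add_zero]) fun s t hs hst ht => ?_
      refine (hia s t hs.le hst ht).trans_eq (intervalIntegral.integral_congr fun x hx => ?_)
      simp only [h0 x (hmem hs hst ht hx), Real.zero_rpow (show p ≠ 0 by linarith), mul_zero,
        add_zero]
  obtain ⟨M, hM⟩ := bounded_of_bernoulli (hq.trans_le hqp) hB hCpos hτ hRd (by rwa [hR0]) hRm hGR
    hne (by rwa [hR0])
  exact ⟨M, fun t ht => (hle t ht).trans (hM t ht)⟩

theorem bounded_of_integral_inequalities {p q B K τ c : ℝ} (hq : 1 < q) (hqp : q ≤ p)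
    (hB : 0 < B) (hK : 0 < K) (hτ : 0 < τ) {a b : ℝ → ℝ} (ha : ContinuousOn a (Ico 0 τ))
    (hb : ContinuousOn b (Ico 0 τ)) (ha0 : ∀ t, 0 ≤ a t) (hb0 : ∀ t, 0 ≤ b t)
    (hc : c = a 0 + b 0) (hcpos : 0 < c)
    (hia : ∀ s t, 0 ≤ s → s ≤ t → t < τ → a t - a s ≤ ∫ x in s..t, (B * a x + K * b x ^ p))
    (hib : ∀ s t, 0 ≤ s → s ≤ t → t < τ →
      b t - b s ≤ ∫ x in s..t, (B * b x + K * c ^ (p - q) * a x ^ q))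
    (hT : τ ≤ 1 / (B * (p - 1)) *
      Real.log (1 + B / (if q < p then 2 * K else K) * c ^ (1 - p))) :
    ∃ M, ∀ t ∈ Ico 0 τ, a t + b t ≤ M := by
  -- Freezing a and b at their initial values for t < 0 makes R differentiable from both sides at 0.
  have hmaps : MapsTo (fun t : ℝ => max t 0) (Iio τ) (Ico 0 τ) := fun t ht =>
    ⟨le_max_right _ _, max_lt ht hτ⟩
  have hmax : ContinuousOn (fun t : ℝ => max t 0) (Iio τ) := by fun_prop
  have hcongr : ∀ (F : ℝ → ℝ → ℝ) {s t : ℝ}, 0 ≤ s → s ≤ t →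
      ∫ x in s..t, F (a x) (b x) = ∫ x in s..t, F (a (max x 0)) (b (max x 0)) := by
    intro F s t hs hst
    refine intervalIntegral.integral_congr fun x hx => ?_
    rw [uIcc_of_le hst] at hx
    simp only [max_eq_left (hs.trans hx.1)]
  obtain ⟨M, hM⟩ := bounded_of_integral_inequalities_aux hq hqp hB hK hτ
    (a := fun t => a (max t 0)) (b := fun t => b (max t 0)) (ha.comp hmax hmaps)
    (hb.comp hmax hmaps) (fun t => ha0 _) (fun t => hb0 _) (by simpa using hc) hcpos
    (fun s t hs hst ht => by
      rw [max_eq_left hs, max_eq_left (hs.trans hst)]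
      exact (hia s t hs hst ht).trans_eq
        (hcongr (fun y z => B * y + K * z ^ p) hs hst))
    (fun s t hs hst ht => by
      rw [max_eq_left hs, max_eq_left (hs.trans hst)]
      exact (hib s t hs hst ht).trans_eq
        (hcongr (fun y z => B * z + K * c ^ (p - q) * y ^ q) hs hst)) hT
  exact ⟨M, fun t ht => by simpa [max_eq_left ht.1] using hM t ht⟩

end Comparison

/-! ### The energy inequality and the constants -/

section EnergyInequality

variable {N : ℕ} {Ω : Set (EuclideanSpace ℝ (Fin N))}

theorem two_mul_inner_le {H : Type*} [NormedAddCommGroup H] [InnerProductSpace ℝ H] (x y : H)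
    {ε : ℝ} (hε : 0 < ε) : 2 * ⟪x, y⟫ ≤ ε * ‖y‖ ^ 2 + ‖x‖ ^ 2 / ε := by
  have h1 := real_inner_le_norm x y
  have h2 : ε * ‖y‖ ^ 2 + ‖x‖ ^ 2 / ε - 2 * (‖x‖ * ‖y‖) = (ε * ‖y‖ - ‖x‖) ^ 2 / ε := by
    field_simp; ring
  have h3 : 0 ≤ (ε * ‖y‖ - ‖x‖) ^ 2 / ε := by positivity
  linarith

/-- Here g is Δ²u and d is Δu. Young's inequality on ⟪g, d⟫ and ⟪g, F⟫ produces (h/ε' + k/ε)‖g‖²,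
which the balance condition cancels against 2δ‖g‖². -/
theorem two_mul_inner_le_of_eq {H : Type*} [NormedAddCommGroup H] [InnerProductSpace ℝ H]
    {g w d F : H} {δ h k ε ε' : ℝ} (hh : 0 < h) (hk : 0 < k) (hε : 0 < ε) (hε' : 0 < ε')
    (hbal : h / ε' + k / ε = 2 * δ) (he : w + δ • g - h • d = k • F) :
    2 * ⟪g, w⟫ ≤ h * ε' * ‖d‖ ^ 2 + k * ε * ‖F‖ ^ 2 := by
  have hw : w = k • F + h • d - δ • g := by rw [← he]; abel
  rw [hw, inner_sub_right, inner_add_right, real_inner_smul_right, real_inner_smul_right,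
    real_inner_smul_right, real_inner_self_eq_norm_sq]
  have h1 := mul_le_mul_of_nonneg_left (two_mul_inner_le g F hε) hk.le
  have h2 := mul_le_mul_of_nonneg_left (two_mul_inner_le g d hε') hh.le
  have h3 : δ * ‖g‖ ^ 2 * 2 = h * (‖g‖ ^ 2 / ε') + k * (‖g‖ ^ 2 / ε) := by
    rw [show δ * ‖g‖ ^ 2 * 2 = 2 * δ * ‖g‖ ^ 2 by ring, ← hbal]
    ring
  linarith

theorem InSolutionSpace.exists_bilaplacian (hΩ : IsOpen Ω) {T : ℝ} {u ut : ℝ → L2 Ω}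
    (hu : InSolutionSpace Ω T u ut) :
    ∃ g : ℝ → L2 Ω, MemLp g 2 (volume.restrict (Ioo 0 T)) ∧
      ∀ᵐ t ∂(volume.restrict (Ioo 0 T)), IsWeakLaplacian Ω (weakLaplacian Ω (u t)) (g t) := by
  obtain ⟨D, hD⟩ := hu.sq_integrable_W4
  refine ⟨fun t => ∑ i, ∑ j, D 4 ![i, i, j, j] t,
    memLp_finsetSum _ fun i _ => memLp_finsetSum _ fun j _ => (hD 4 le_rfl _).1, ?_⟩
  have hall : ∀ᵐ t ∂(volume.restrict (Ioo 0 T)), ∀ i j,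
      IsWeakDeriv Ω ![i, i, j, j] (u t) (D 4 ![i, i, j, j] t) :=
    ae_all_iff.2 fun i => ae_all_iff.2 fun j => (hD 4 le_rfl _).2
  filter_upwards [hall, ae_restrict_mem measurableSet_Ioo] with t ht htm
  exact isWeakLaplacian_weakLaplacian ((hu.mem_W0 t (Ioo_subset_Icc_self htm)).isWeakLaplacian hΩ) ht

/-- The energy inequality for one equation of the system. -/
theorem energy_inequality (hN : 2 ≤ N) (hΩ : IsOpen Ω) (hΩb : Bornology.IsBounded Ω) {r : ℝ}
    (hr : 1 < r) (hrN : 4 < N → 2 * r < 2 * (N : ℝ) / ((N : ℝ) - 4)) {T B L : ℝ}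
    {δ h k ε ε' f : ℝ → ℝ} (hf : ∀ s : ℝ, 0 ≤ s → 0 ≤ f s ∧ f s ≤ s ^ r)
    {u ut z zt : ℝ → L2 Ω} (hu : InSolutionSpace Ω T u ut) (hz : InSolutionSpace Ω T z zt)
    (hz0 : ∀ t ∈ Icc 0 T, ∀ᵐ x ∂(volume.restrict Ω), 0 ≤ z t x)
    (hsrc : SourceSqIntegrable Ω T f z) (heq : SolvesEquation Ω T δ h k f u ut z)
    (hpos : ∀ t ∈ Ioo 0 T, 0 < h t ∧ 0 < k t ∧ 0 < ε t ∧ 0 < ε' t)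
    (hbal : ∀ t ∈ Ioo 0 T, h t / ε' t + k t / ε t = 2 * δ t)
    (hB : ∀ t ∈ Ioo 0 T, h t * ε' t ≤ B)
    (hL : ∀ t ∈ Ioo 0 T, k t * ε t * sobolevConst Ω (2 * r) ^ (2 * r) ≤ L)
    {s t : ℝ} (hs : 0 ≤ s) (hst : s ≤ t) (htT : t < T) :
    ‖weakLaplacian Ω (u t)‖ ^ 2 - ‖weakLaplacian Ω (u s)‖ ^ 2 ≤
      ∫ x in s..t, (B * ‖weakLaplacian Ω (u x)‖ ^ 2 + L * (‖weakLaplacian Ω (z x)‖ ^ 2) ^ r) := by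
  obtain ⟨g, hg, hglap⟩ := hu.exists_bilaplacian hΩ
  obtain ⟨F, -, hF⟩ := hsrc
  have hsub : Ioc s t ⊆ Ioo 0 T := fun x hx => ⟨hs.trans_lt hx.1, hx.2.trans_lt htT⟩
  rw [norm_sq_sub_norm_sq_eq_integral (a := fun t => weakLaplacian Ω (u t)) hu.sq_integrable_ut hg
    hu.eq_integral_ut hu.continuous_W0 ?_ hs hst htT, intervalIntegral.integral_of_le hst]
  · refine setIntegral_mono_on_ae ?_ ?_ measurableSet_Ioc ?_
    · exact ((integrable_inner_of_memLp_two hg hu.sq_integrable_ut).const_mul 2).mono_measure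
        (Measure.restrict_mono_set volume hsub)
    · have hc : ContinuousOn (fun x => B * ‖weakLaplacian Ω (u x)‖ ^ 2 +
          L * (‖weakLaplacian Ω (z x)‖ ^ 2) ^ r) (Icc 0 T) :=
        ((hu.continuous_W0.norm.pow 2).const_mul B).add
          (((hz.continuous_W0.norm.pow 2).rpow_const fun x _ => Or.inr (by linarith)).const_mul L)
      exact (hc.integrableOn_compact isCompact_Icc).mono_set (hsub.trans Ioo_subset_Icc_self)
    · have hall := ((hglap.and hF).and heq)
      rw [ae_restrict_iff' measurableSet_Ioo] at hall
      filter_upwards [hall] with x hx hxm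
      have hxI := hsub hxm
      obtain ⟨⟨hgx, hFx⟩, hex⟩ := hx hxI
      obtain ⟨hh, hk, hε, hε'⟩ := hpos x hxI
      have hL2 : ut x + δ x • g x - h x • weakLaplacian Ω (u x) = k x • F x := by
        -- The iterated weak Laplacian in the equation is a genuine one here, not the default value
        -- 0.
        rw [hgx.eq_weakLaplacian hΩ] at hex
        refine Lp.ext ?_
        filter_upwards [hex, hFx, Lp.coeFn_sub (ut x + δ x • g x) (h x • weakLaplacian Ω (u x)),
          Lp.coeFn_add (ut x) (δ x • g x), Lp.coeFn_smul (δ x) (g x),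
          Lp.coeFn_smul (h x) (weakLaplacian Ω (u x)), Lp.coeFn_smul (k x) (F x)]
          with y e1 e2 e3 e4 e5 e6 e7
        rw [e3, Pi.sub_apply, e4, Pi.add_apply, e5, e6, e7, Pi.smul_apply, Pi.smul_apply,
          Pi.smul_apply, smul_eq_mul, smul_eq_mul, smul_eq_mul, e2, e1]
      have hxc := Ioo_subset_Icc_self hxI
      have h1 := two_mul_inner_le_of_eq hh hk hε hε' (hbal x hxI) hL2
      have h2 := norm_source_sq_le hN hΩ hΩb hr hrN hf (hz.mem_W0 x hxc) (hz0 x hxc) hFx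
      calc 2 * ⟪g x, ut x⟫ ≤ h x * ε' x * ‖weakLaplacian Ω (u x)‖ ^ 2 + k x * ε x * ‖F x‖ ^ 2 := h1
        _ ≤ B * ‖weakLaplacian Ω (u x)‖ ^ 2 + k x * ε x *
            (sobolevConst Ω (2 * r) ^ (2 * r) * (‖weakLaplacian Ω (z x)‖ ^ 2) ^ r) := by
          gcongr
          exact hB x hxI
        _ ≤ _ := by
          rw [← mul_assoc]
          gcongr
          exact hL x hxI
  -- The symmetry required by the chain rule is Green's formula, with an exceptional set of x
  -- independent of t'.
  · filter_upwards [hglap] with x hx t' ht'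
    exact ((hu.mem_W0 t' ht').inner_weakLaplacian hΩ hx).symm

theorem le_supOn {τ : ℝ} {g : ℝ → ℝ} (hg : BddAbove (g '' Ioo 0 τ)) {t : ℝ} (ht : t ∈ Ioo 0 τ) :
    g t ≤ supOn τ g :=
  le_csSup hg (mem_image_of_mem g ht)

theorem bddAbove_image_mul_const {s : Set ℝ} {g : ℝ → ℝ} (hg : BddAbove (g '' s)) {c : ℝ}
    (hc : 0 ≤ c) : BddAbove ((fun t => g t * c) '' s) := by
  obtain ⟨M, hM⟩ := hg
  refine ⟨M * c, ?_⟩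
  rintro _ ⟨t, ht, rfl⟩
  exact mul_le_mul_of_nonneg_right (hM (mem_image_of_mem g ht)) hc

/-- The constant in front of the source terms: `A` if `p > q` and `Ã` if `p = q`. -/
noncomputable def sourceConst (Ω : Set (EuclideanSpace ℝ (Fin N))) (P : SystemData)
    (τ p q Φ₀ : ℝ) (ε₁ ε₃ : ℝ → ℝ) : ℝ :=
  if q < p then constA Ω P τ p q Φ₀ ε₁ ε₃ else constATilde Ω P τ p ε₁ ε₃

theorem lowerTime_eq (Ω : Set (EuclideanSpace ℝ (Fin N))) (P : SystemData)
    (τ p q Φ₀ : ℝ) (ε₁ ε₂ ε₃ ε₄ : ℝ → ℝ) :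
    lowerTime Ω P τ p q Φ₀ ε₁ ε₂ ε₃ ε₄ = 1 / (constB P τ ε₂ ε₄ * (p - 1)) *
      Real.log (1 + constB P τ ε₂ ε₄ /
        (if q < p then 2 * sourceConst Ω P τ p q Φ₀ ε₁ ε₃ else sourceConst Ω P τ p q Φ₀ ε₁ ε₃) *
          Φ₀ ^ (1 - p)) := by
  unfold lowerTime sourceConst
  split_ifs <;> rfl

section Constants

variable {P : SystemData} {τ p q Φ₀ : ℝ} {ε₁ ε₂ ε₃ ε₄ : ℝ → ℝ} {t : ℝ}

theorem IsWeight.source₁_le (hε : IsWeight P τ ε₁ ε₂ ε₃ ε₄) (ht : t ∈ Ioo 0 τ) :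
    P.k₁ t * ε₁ t * sobolevConst Ω (2 * p) ^ (2 * p) ≤ sourceConst Ω P τ p q Φ₀ ε₁ ε₃ := by
  have hS := Real.rpow_nonneg (sobolevConst_nonneg Ω (2 * p)) (2 * p)
  unfold sourceConst
  split_ifs
  · exact (le_supOn (bddAbove_image_mul_const hε.bdd₁ hS) ht).trans (le_max_right _ _)
  · unfold constATilde
    rw [mul_comm]
    gcongr
    exact (le_supOn hε.bdd₁ ht).trans (le_max_right _ _)

/-- The factor Φ₀^{q-p} built into A is compensated by Φ₀^{p-q}, so one constant serves both
equations. -/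
theorem IsWeight.source₂_le (hε : IsWeight P τ ε₁ ε₂ ε₃ ε₄) (hqp : q ≤ p) (hΦ : 0 < Φ₀)
    (ht : t ∈ Ioo 0 τ) :
    P.k₂ t * ε₃ t * sobolevConst Ω (2 * q) ^ (2 * q) ≤
      sourceConst Ω P τ p q Φ₀ ε₁ ε₃ * Φ₀ ^ (p - q) := by
  have hS := Real.rpow_nonneg (sobolevConst_nonneg Ω (2 * q)) (2 * q)
  have hΦ' : 0 < Φ₀ ^ (q - p) := by positivity
  unfold sourceConst
  split_ifs with hlt
  · have h1 : P.k₂ t * ε₃ t * sobolevConst Ω (2 * q) ^ (2 * q) * Φ₀ ^ (q - p) ≤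
        constA Ω P τ p q Φ₀ ε₁ ε₃ :=
      (le_supOn (bddAbove_image_mul_const (bddAbove_image_mul_const hε.bdd₃ hS) hΦ'.le) ht).trans
        (le_max_left _ _)
    have h2 := mul_le_mul_of_nonneg_right h1 (Real.rpow_nonneg hΦ.le (p - q))
    rwa [mul_assoc, ← Real.rpow_add hΦ, sub_add_sub_cancel, sub_self, Real.rpow_zero,
      mul_one] at h2
  · obtain rfl : q = p := le_antisymm hqp (not_lt.1 hlt)
    unfold constATilde
    rw [sub_self, Real.rpow_zero, mul_one, mul_comm]
    gcongr
    exact (le_supOn hε.bdd₃ ht).trans (le_max_left _ _)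

theorem IsWeight.convection_le (hε : IsWeight P τ ε₁ ε₂ ε₃ ε₄) (ht : t ∈ Ioo 0 τ) :
    P.h₁ t * ε₂ t ≤ constB P τ ε₂ ε₄ ∧ P.h₂ t * ε₄ t ≤ constB P τ ε₂ ε₄ :=
  ⟨(le_supOn hε.bdd₂ ht).trans (le_max_left _ _), (le_supOn hε.bdd₄ ht).trans (le_max_right _ _)⟩

end Constants

end EnergyInequality

end FourthOrder

/-! ### Proof of the lower bound -/

open FourthOrder in
theorem theorem1p1 (N : ℕ) (hN : 2 ≤ N)
    (Ω : Set (EuclideanSpace ℝ (Fin N)))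
    (hΩ_open : IsOpen Ω) (hΩ_conn : IsConnected Ω) (hΩ_bdd : Bornology.IsBounded Ω)
    (p q : ℝ) (hq : 1 < q) (hqp : q ≤ p)
    (hp : 4 < N → 2 * p < 2 * (N : ℝ) / ((N : ℝ) - 4))
    (P : FourthOrder.SystemData)
    (hf₁ : ∀ s : ℝ, 0 ≤ s → 0 ≤ P.f₁ s ∧ P.f₁ s ≤ s ^ p)
    (hf₂ : ∀ s : ℝ, 0 ≤ s → 0 ≤ P.f₂ s ∧ P.f₂ s ≤ s ^ q)
    (tstar : ℝ) (htstar : 0 < tstar)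
    (hδ : ∀ t ∈ Ioo 0 tstar, 0 < P.δ₁ t ∧ 0 < P.δ₂ t)
    (hh : ∀ t ∈ Ioo 0 tstar, 0 < P.h₁ t ∧ 0 < P.h₂ t)
    (hk : ∀ t ∈ Ioo 0 tstar, 0 < P.k₁ t ∧ 0 < P.k₂ t)
    (u₀ v₀ : FourthOrder.L2 Ω) (u v : ℝ → FourthOrder.L2 Ω)
    (hsol : ∀ T ∈ Ioo 0 tstar, FourthOrder.IsNonnegSolutionOn Ω P u₀ v₀ T u v)
    (hΦ₀ : 0 < FourthOrder.energy Ω u₀ v₀)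
    (ε₁ ε₂ ε₃ ε₄ : ℝ → ℝ) (hε : FourthOrder.IsWeight P tstar ε₁ ε₂ ε₃ ε₄)
    (T : ℝ)
    (hT : T = FourthOrder.lowerTime Ω P tstar p q (FourthOrder.energy Ω u₀ v₀) ε₁ ε₂ ε₃ ε₄) :
    (∃ M : ℝ, ∀ t ∈ Icc 0 T, t < tstar → FourthOrder.energy Ω (u t) (v t) ≤ M) ∧
    (Tendsto (fun t => FourthOrder.energy Ω (u t) (v t)) (𝓝[<] tstar) atTop →
      T < tstar ∧ ∃ M : ℝ, ∀ t ∈ Icc 0 T, FourthOrder.energy Ω (u t) (v t) ≤ M) := by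
  have hcont : ∀ T' ∈ Ioo 0 tstar, ContinuousOn (fun t => weakLaplacian Ω (u t)) (Icc 0 T') ∧
      ContinuousOn (fun t => weakLaplacian Ω (v t)) (Icc 0 T') := fun T' hT' => by
    obtain ⟨-, -, -, -, -, ut, vt, hu, hv, -, -⟩ := hsol T' hT'
    exact ⟨hu.continuous_W0, hv.continuous_W0⟩
  -- Solutions are given on [0, T'] with T' < t*; the midpoint supplies a T' strictly beyond t, as
  -- the energy inequality requires.
  have hmid : ∀ t < tstar, (max t 0 + tstar) / 2 ∈ Ioo 0 tstar ∧ t < (max t 0 + tstar) / 2 := by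
    intro t ht
    have h1 := le_max_left t 0
    have h2 := le_max_right t 0
    have h3 : max t 0 < tstar := max_lt ht htstar
    exact ⟨⟨by linarith, by linarith⟩, by linarith⟩
  have hbefore : T < tstar → ∃ M : ℝ, ∀ t ∈ Icc 0 T, energy Ω (u t) (v t) ≤ M := by
    intro hlt
    obtain ⟨hm, hTm⟩ := hmid T hlt
    obtain ⟨hcu, hcv⟩ := hcont _ hm
    have hc : ContinuousOn (fun t => energy Ω (u t) (v t)) (Icc 0 T) :=
      ((hcu.norm.pow 2).add (hcv.norm.pow 2)).mono (Icc_subset_Icc_right hTm.le)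
    obtain ⟨M, hM⟩ := (isCompact_Icc.image_of_continuousOn hc).bddAbove
    exact ⟨M, fun t ht => hM (mem_image_of_mem _ ht)⟩
  have hafter : tstar ≤ T → ∃ M : ℝ, ∀ t ∈ Ico 0 tstar, energy Ω (u t) (v t) ≤ M := by
    intro hle
    set K := sourceConst Ω P tstar p q (energy Ω u₀ v₀) ε₁ ε₃ with hK
    set B := constB P tstar ε₂ ε₄ with hBdef
    have hhalf : tstar / 2 ∈ Ioo 0 tstar := ⟨by linarith, by linarith⟩
    have hBpos : 0 < B :=
      (mul_pos (hh _ hhalf).1 (hε.pos _ hhalf).2.1).trans_le (hε.convection_le hhalf).1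
    have hTK := hT.trans (lowerTime_eq Ω P tstar p q _ ε₁ ε₂ ε₃ ε₄)
    have hu0 : u 0 = u₀ := (hsol _ hhalf).1
    have hv0 : v 0 = v₀ := (hsol _ hhalf).2.1
    have hSpos : 0 < sobolevConst Ω (2 * p) := by
      obtain ⟨-, -, -, -, -, ut, vt, hu, hv, -, -⟩ := hsol _ hhalf
      have h0 : (0 : ℝ) ∈ Icc 0 (tstar / 2) := ⟨le_rfl, hhalf.1.le⟩
      -- Since Φ₀ > 0, one of the initial values has nonzero Laplacian and witnesses positivity of
      -- the Sobolev constant.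
      by_cases hu' : weakLaplacian Ω (u 0) = 0
      · refine sobolevConst_pos hN hΩ_open hΩ_bdd (by linarith) hp (hv.mem_W0 0 h0) fun hv' => ?_
        simp [energy, ← hu0, ← hv0, hu', hv'] at hΦ₀
      · exact sobolevConst_pos hN hΩ_open hΩ_bdd (by linarith) hp (hu.mem_W0 0 h0) hu'
    have hKpos : 0 < K :=
      (mul_pos (mul_pos (hk _ hhalf).1 (hε.pos _ hhalf).1) (Real.rpow_pos_of_pos hSpos _)).trans_le
        (hε.source₁_le hhalf)
    refine bounded_of_integral_inequalities (a := fun t => ‖weakLaplacian Ω (u t)‖ ^ 2)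
      (b := fun t => ‖weakLaplacian Ω (v t)‖ ^ 2) hq hqp hBpos hKpos htstar ?_ ?_
      (fun t => by positivity) (fun t => by positivity) (c := energy Ω u₀ v₀)
      (by rw [hu0, hv0]; rfl) hΦ₀ ?_ ?_ (hle.trans_eq hTK)
    · intro t ht
      obtain ⟨hm, htm⟩ := hmid t ht.2
      refine (((hcont _ hm).1.norm.pow 2) t ⟨ht.1, htm.le⟩).mono_of_mem_nhdsWithin ?_
      filter_upwards [self_mem_nhdsWithin, mem_nhdsWithin_of_mem_nhds (Iio_mem_nhds htm)]
        with x hx hxm using ⟨hx.1, le_of_lt hxm⟩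
    · intro t ht
      obtain ⟨hm, htm⟩ := hmid t ht.2
      refine (((hcont _ hm).2.norm.pow 2) t ⟨ht.1, htm.le⟩).mono_of_mem_nhdsWithin ?_
      filter_upwards [self_mem_nhdsWithin, mem_nhdsWithin_of_mem_nhds (Iio_mem_nhds htm)]
        with x hx hxm using ⟨hx.1, le_of_lt hxm⟩
    · intro s t hs hst ht
      obtain ⟨hm, htm⟩ := hmid t ht
      obtain ⟨-, -, hnn, hs1, hs2, ut, vt, hu, hv, he1, he2⟩ := hsol _ hm
      have hin : ∀ {x}, x ∈ Ioo 0 ((max t 0 + tstar) / 2) → x ∈ Ioo 0 tstar :=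
        fun hx => ⟨hx.1, hx.2.trans hm.2⟩
      exact energy_inequality hN hΩ_open hΩ_bdd (hq.trans_le hqp) hp hf₁ hu hv
        (fun x hx => (hnn x hx).2) hs1 he1
        (fun x hx => ⟨(hh x (hin hx)).1, (hk x (hin hx)).1, (hε.pos x (hin hx)).1,
          (hε.pos x (hin hx)).2.1⟩)
        (fun x hx => hε.balance₁ x (hin hx)) (fun x hx => (hε.convection_le (hin hx)).1)
        (fun x hx => hε.source₁_le (hin hx)) hs hst htm
    · intro s t hs hst ht
      obtain ⟨hm, htm⟩ := hmid t ht
      obtain ⟨-, -, hnn, hs1, hs2, ut, vt, hu, hv, he1, he2⟩ := hsol _ hm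
      have hin : ∀ {x}, x ∈ Ioo 0 ((max t 0 + tstar) / 2) → x ∈ Ioo 0 tstar :=
        fun hx => ⟨hx.1, hx.2.trans hm.2⟩
      exact energy_inequality hN hΩ_open hΩ_bdd hq
        (fun h4 => (mul_le_mul_of_nonneg_left hqp zero_le_two).trans_lt (hp h4)) hf₂ hv hu
        (fun x hx => (hnn x hx).1) hs2 he2
        (fun x hx => ⟨(hh x (hin hx)).2, (hk x (hin hx)).2, (hε.pos x (hin hx)).2.2.1,
          (hε.pos x (hin hx)).2.2.2⟩)
        (fun x hx => hε.balance₂ x (hin hx)) (fun x hx => (hε.convection_le (hin hx)).2)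
        (fun x hx => hε.source₂_le hqp hΦ₀ (hin hx)) hs hst htm
  refine ⟨?_, fun hblow => ?_⟩
  · rcases lt_or_ge T tstar with hlt | hge
    · obtain ⟨M, hM⟩ := hbefore hlt
      exact ⟨M, fun t ht _ => hM t ht⟩
    · obtain ⟨M, hM⟩ := hafter hge
      exact ⟨M, fun t ht hlt => hM t ⟨ht.1, hlt⟩⟩
  · have hlt : T < tstar := by
      by_contra! hge
      obtain ⟨M, hM⟩ := hafter hge
      obtain ⟨t, hMt, ht⟩ := ((hblow.eventually_gt_atTop M).and
        (Ioo_mem_nhdsLT htstar)).exists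
      exact (hM t (Ioo_subset_Ico_self ht)).not_gt hMt
    exact ⟨hlt, hbefore hlt⟩
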